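/- Let $M$ be a connected smooth manifold of dimension $m>2$ (Hausdorff, second countable) with a smooth symmetric $(0,2)$-tensor field $g=\langle\cdot,\cdot\rangle$. For $p\in M$ let $\mathrm{Rad}_p=\{v\in T_pM:\langle v,w\rangle=0\ \forall w\in T_pM\}$, and let $\Sigma=\{p:\mathrm{Rad}_p\neq 0\}$. Suppose that $(M,g)$ is a transverse Riemann–Lorentz space with tangent radical, i.e. * $\Sigma\neq\emptyset$, and in every local coordinate system $\det(g_{ab})$ has non-zero differential at the points of $\Sigma$ (so that $\Sigma$ is a smooth hypersurface and $\dim\mathrm{Rad}_p=1$ for $p\in\Sigma$); * $\mathrm{Rad}_p\subset T_p\Sigma$ for all $p\in\Sigma$; * $g$ changes from Riemannian to Lorentzian across $\Sigma$: every $p\in\Sigma$ is a limit of points at which $g$ is positive definite and of points at which $g$ is Lorentzian. For smooth vector fields $\mathcal A,\mathcal B$ on $M$ put, on $M\setminus\Sigma$, with $\nabla$ the Levi-Civita connection of $g|_{M\setminus\Sigma}$ and $R(\mathcal A,\mathcal B)\mathcal C=\nabla_{\mathcal A}\nabla_{\mathcal B}\mathcal C-\nabla_{\mathcal B}\nabla_{\mathcal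 A}\mathcal C-\nabla_{[\mathcal A,\mathcal B]}\mathcal C$, $$K_{\mathcal A\wedge\mathcal B}=\frac{\langle R(\mathcal A,\mathcal B)\mathcal A,\mathcal B\rangle}{\det(g_{\mathcal A\wedge\mathcal B})},\qquad g_{\mathcal A\wedge\mathcal B}=\begin{pmatrix}\langle\mathcal A,\mathcal A\rangle&\langle\mathcal A,\mathcal B\rangle\\ \langle\mathcal B,\mathcal A\rangle&\langle\mathcal B,\mathcal B\rangle\end{pmatrix}.$$ Say that $K_{\mathcal A\wedge\mathcal B}$ has a good limit on $\Sigma$ if there is an open neighbourhood $U$ of $\Sigma$ such that $\mathrm{rank}(g_{\mathcal A\wedge\mathcal B})=2$ on $U\setminus\Sigma$ and $K_{\mathcal A\wedge\mathcal B}|_{U\setminus\Sigma}$ extends to a smooth function on $U$; the restriction of this function to $\Sigma$ is the limit. For smooth vector fields $A,B$ along $\Sigma$ (sections of $TM|_\Sigma$), say that $K_{A\wedge B}$ is well-defined if there are smooth vector fields $\mathcal A,\mathcal B$ on $M$ extending $A,B$ for which $K_{\mathcal A\wedge\mathcal B}$ has a good limit on $\Sigma$, and this limit is the same for all extensions of $A,B$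 for which it exists. **Proposition.** Let $A,B$ be smooth vector fields along $\Sigma$ such that, at every $p\in\Sigma$, $\mathrm{rank}(g_{A\wedge B})=1$ and $\mathrm{Rad}_p\subset\mathrm{span}(A(p),B(p))$. Then $K_{A\wedge B}$ is not well-defined: if some extensions of $A,B$ have a sectional curvature with a good limit on $\Sigma$, then there are two pairs of extensions of $A,B$ whose sectional curvatures both have good limits, and these limits are different. -/

import Mathlib

open scoped Manifold ContDiff Topology

noncomputable section

namespace SingularMetric

variable {m : ℕ} {M : Type*} [TopologicalSpace M] [ChartedSpace (EuclideanSpace ℝ (Fin m)) M]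
  [IsManifold (𝓡 m) ∞ M]

/-! ### Vector fields and `(0,2)`-tensor fields -/

/-- A (not necessarily smooth) vector field on `M`. -/
abbrev VField (m : ℕ) (M : Type*) [TopologicalSpace M]
    [ChartedSpace (EuclideanSpace ℝ (Fin m)) M] : Type _ :=
  (p : M) → TangentSpace (𝓡 m) p

/-- A (not necessarily smooth) field of bilinear forms on the tangent spaces of `M`. -/
abbrev FormField (m : ℕ) (M : Type*) [TopologicalSpace M]
    [ChartedSpace (EuclideanSpace ℝ (Fin m)) M] : Type _ :=
  (p : M) → (TangentSpace (𝓡 m) p →L[ℝ] TangentSpace (𝓡 m) p →L[ℝ] ℝ)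

/-- A vector field is smooth along the set `s`. -/
def SmoothVFieldOn (A : VField m M) (s : Set M) : Prop :=
  ContMDiffOn (𝓡 m) (𝓡 m).tangent ∞ (fun p ↦ (⟨p, A p⟩ : TangentBundle (𝓡 m) M)) s

/-- A vector field on the whole of `M` is smooth. -/
def SmoothVField (A : VField m M) : Prop :=
  ContMDiff (𝓡 m) (𝓡 m).tangent ∞ (fun p ↦ (⟨p, A p⟩ : TangentBundle (𝓡 m) M))

/-- A field of bilinear forms is smooth, as a section of `Hom(TM, Hom(TM, ℝ))`. -/
def SmoothFormField (g : FormField m M) : Prop :=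
  ContMDiff (𝓡 m)
    ((𝓡 m).prod 𝓘(ℝ, EuclideanSpace ℝ (Fin m) →L[ℝ] EuclideanSpace ℝ (Fin m) →L[ℝ] ℝ)) ∞
    (fun p ↦ Bundle.TotalSpace.mk'
      (EuclideanSpace ℝ (Fin m) →L[ℝ] EuclideanSpace ℝ (Fin m) →L[ℝ] ℝ)
      (E := fun p : M ↦ TangentSpace (𝓡 m) p →L[ℝ] TangentSpace (𝓡 m) p →L[ℝ] ℝ) p (g p))

/-! ### The radical, the singular set, and its tangent vectors -/

/-- The radical of `g` at `p`: the vectors orthogonal to the whole of `T_p M`. -/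
def radical (g : FormField m M) (p : M) : Submodule ℝ (TangentSpace (𝓡 m) p) :=
  LinearMap.ker (g p).toLinearMap

/-- The set of points at which `g` fails to have maximal rank. -/
def singularSet (g : FormField m M) : Set M :=
  {p | radical g p ≠ ⊥}

/-- The determinant `det (g_{ab})` in the local coordinate system `e`, as a function of the
coordinates; `g_{ab} = g (∂_a, ∂_b)`, where `∂_a` is the image of the `a`-th unit vector under the
differential of `e⁻¹`. -/
def coordDet (g : FormField m M) (e : OpenPartialHomeomorph M (EuclideanSpace ℝ (Fin m)))
    (y : EuclideanSpace ℝ (Fin m)) : ℝ :=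
  Matrix.det (Matrix.of fun a b : Fin m ↦
    g (e.symm y)
      (mfderiv (𝓡 m) (𝓡 m) e.symm y (EuclideanSpace.single a (1 : ℝ)))
      (mfderiv (𝓡 m) (𝓡 m) e.symm y (EuclideanSpace.single b (1 : ℝ))))

/-- `v ∈ T_p M` is tangent to the set `S ∋ p`: it is the velocity at time `0` of a smooth curve
which runs inside `S`. -/
def TangentTo (S : Set M) (p : M) (v : TangentSpace (𝓡 m) p) : Prop :=
  ∃ γ : ℝ → M, ContMDiff 𝓘(ℝ, ℝ) (𝓡 m) ∞ γ ∧ (∀ t, γ t ∈ S) ∧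
    (⟨γ 0, mfderiv 𝓘(ℝ, ℝ) (𝓡 m) γ 0 (1 : ℝ)⟩ : TangentBundle (𝓡 m) M) = ⟨p, v⟩

/-! ### Transverse Riemann-Lorentz spaces with tangent radical -/

/-- `g` is positive definite at `p`. -/
def RiemannAt (g : FormField m M) (p : M) : Prop :=
  ∀ v : TangentSpace (𝓡 m) p, v ≠ 0 → 0 < g p v v

/-- `g` is Lorentzian at `p` (nondegenerate of index one): there is a timelike vector on whose
orthogonal complement `g` is positive definite. -/
def LorentzAt (g : FormField m M) (p : M) : Prop :=
  ∃ t : TangentSpace (𝓡 m) p, g p t t < 0 ∧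
    ∀ v : TangentSpace (𝓡 m) p, g p t v = 0 → v ≠ 0 → 0 < g p v v

/-- `(M, g)` is a transverse Riemann-Lorentz space with tangent radical. -/
structure IsTransverseRiemannLorentzTangent (g : FormField m M) : Prop where
  smooth : SmoothFormField g
  symm : ∀ (p : M) (v w : TangentSpace (𝓡 m) p), g p v w = g p w v
  /-- The metric is singular somewhere. -/
  singular_nonempty : (singularSet g).Nonempty
  /-- In every local coordinate system, `det (g_{ab})` has non-zero differential at the points of
  the singular set. -/
  transverse : ∀ e ∈ IsManifold.maximalAtlas (𝓡 m) ∞ M, ∀ y ∈ e.target,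
    e.symm y ∈ singularSet g → fderiv ℝ (coordDet g e) y ≠ 0
  /-- The radical is tangent to the singular hypersurface. -/
  tangent_radical : ∀ p ∈ singularSet g, ∀ v ∈ radical g p, TangentTo (singularSet g) p v
  /-- The signature changes from Riemann to Lorentz across the singular hypersurface. -/
  signature_change : ∀ p ∈ singularSet g,
    p ∈ closure {q | RiemannAt g q} ∧ p ∈ closure {q | LorentzAt g q}

/-! ### The Levi-Civita connection outside the singular set, and its curvature -/

/-- The derivative `A(f)` of a function in the direction of a vector field. -/
def dirDeriv (A : VField m M) (f : M → ℝ) (p : M) : ℝ :=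
  mvfderiv (𝓡 m) f p (A p)

/-- The dual connection `□_A B (C)`, given by the Koszul formula. -/
def dualConnection (g : FormField m M) (A B C : VField m M) (p : M) : ℝ :=
  (1 / 2) *
    (dirDeriv A (fun q ↦ g q (B q) (C q)) p
      + dirDeriv B (fun q ↦ g q (C q) (A q)) p
      - dirDeriv C (fun q ↦ g q (A q) (B q)) p
      + g p (VectorField.mlieBracket (𝓡 m) A B p) (C p)
      - g p (VectorField.mlieBracket (𝓡 m) B C p) (A p)
      + g p (VectorField.mlieBracket (𝓡 m) C A p) (B p))

/-- `v` represents `□_A B` at `p`: `⟨v, C⟩ = □_A B (C)` for all vector fields `C` differentiable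
at `p`. -/
def RepresentsDual (g : FormField m M) (A B : VField m M) (p : M)
    (v : TangentSpace (𝓡 m) p) : Prop :=
  ∀ C : VField m M,
    MDifferentiableAt (𝓡 m) (𝓡 m).tangent (fun q ↦ (⟨q, C q⟩ : TangentBundle (𝓡 m) M)) p →
      g p v (C p) = dualConnection g A B C p

open Classical in
/-- The Levi-Civita covariant derivative `∇_A B` of smooth vector fields, at points where `g` is
nondegenerate: there the vector representing `□_A B` exists and is unique. (The value at singular
points is of no significance.) -/
def leviCivita (g : FormField m M) (A B : VField m M) : VField m M := fun p ↦
  if h : ∃ v, RepresentsDual g A B p v then h.choose else 0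

/-- `R(A,B)C = ∇_A ∇_B C - ∇_B ∇_A C - ∇_{[A,B]} C`, outside the singular set. -/
def curvature (g : FormField m M) (A B C : VField m M) : VField m M := fun p ↦
  leviCivita g A (leviCivita g B C) p - leviCivita g B (leviCivita g A C) p
    - leviCivita g (VectorField.mlieBracket (𝓡 m) A B) C p

/-- The Gram matrix of `g` on the pair `A, B` at `p`. -/
def gram (g : FormField m M) (A B : VField m M) (p : M) : Matrix (Fin 2) (Fin 2) ℝ :=
  !![g p (A p) (A p), g p (A p) (B p); g p (B p) (A p), g p (B p) (B p)]

/-- The sectional curvature `K_{A ∧ B} = ⟨R(A,B)A, B⟩ / det (g_{A ∧ B})`, outside the singular set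
and where the Gram determinant does not vanish. -/
def sectionalCurvature (g : FormField m M) (A B : VField m M) (p : M) : ℝ :=
  g p (curvature g A B A p) (B p) / (gram g A B p).det

/-! ### Good limits and independence of the extension -/

/-- `𝒜` is an extension to `M` of the vector field `A` along the singular set. (Only the values of
`A` at the points of the singular set matter.) -/
def IsExtension (g : FormField m M) (A 𝒜 : VField m M) : Prop :=
  SmoothVField 𝒜 ∧ ∀ p ∈ singularSet g, 𝒜 p = A p

/-- The sectional curvature of `𝒜 ∧ ℬ` outside the singular set has a good limit on the singular
set, and `K` is that limit: on a neighbourhood `U` of the singular set, `𝒜 ∧ ℬ` is a nondegenerate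
plane outside the singular set and `K` is a smooth function on `U` which extends the sectional
curvature. -/
def HasLimitingCurvature (g : FormField m M) (𝒜 ℬ : VField m M) (K : M → ℝ) : Prop :=
  ∃ U : Set M, IsOpen U ∧ singularSet g ⊆ U ∧
    ContMDiffOn (𝓡 m) 𝓘(ℝ, ℝ) ∞ K U ∧
    ∀ p ∈ U, p ∉ singularSet g →
      (gram g 𝒜 ℬ p).rank = 2 ∧ K p = sectionalCurvature g 𝒜 ℬ p

/-- `K_{A ∧ B}` is well-defined, for vector fields `A, B` along the singular set: there are
extensions for which the sectional curvature has a good limit, and the value of the limit on the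
singular set is the same for all such extensions. (Extensions without a good limit are not held
against well-definedness, so this is the most permissive form of the notion.) -/
def SectionalCurvatureWellDefined (g : FormField m M) (A B : VField m M) : Prop :=
  (∃ (𝒜 ℬ : VField m M) (K : M → ℝ),
    IsExtension g A 𝒜 ∧ IsExtension g B ℬ ∧ HasLimitingCurvature g 𝒜 ℬ K) ∧
  ∀ (𝒜 ℬ 𝒜' ℬ' : VField m M) (K K' : M → ℝ),
    IsExtension g A 𝒜 → IsExtension g B ℬ → HasLimitingCurvature g 𝒜 ℬ K →
    IsExtension g A 𝒜' → IsExtension g B ℬ' → HasLimitingCurvature g 𝒜' ℬ' K' →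
      ∀ p ∈ singularSet g, K p = K' p

end SingularMetric

end

/-! In a chart put `τ = det g`. Off Σ the curvature tensor is `H + τ⁻¹ P`: `H` is linear in the
second derivatives of `g`, and `P` is quadratic in the Christoffel symbols of the first kind,
contracted with the adjugate of `g`. Both are smooth across Σ, so `P` on Σ is the only obstruction
to a finite limit. On Σ the adjugate is `κ R ⊗ R` with `R` spanning the radical, hence `P` is `κ`
times a 2×2 minor of the symmetric form `II(u,v) = Γ(u,v;R)`. Writing `⟨R,·⟩ = τ w` near Σ gives `κ
w(R) = 1` and `II(v,R) = ½ w(R) dτ(v)` on Σ. Thus `II(R,R) = 0` because the radical is tangent to Σ,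
while `II(z,R) ≠ 0` for every `z` transverse to Σ.

Suppose `K` extends for `a, b`, and write `R = αa + βb`. The Gram determinant of `a, b` is `τδ`,
with `δ ≠ 0` on Σ by the rank-one hypothesis. Finiteness of `K` forces `P(a,b,a,b) = 0` on Σ, so
`II` is degenerate on the plane of `a, b`; since `R` is isotropic for it, `II(a,R) = II(b,R) = 0`.

Now replace `a ∧ b` by `a ∧ b + sχτ z ∧ R`, with `χ` a bump function and `s` a constant. Nothing
changes on Σ, and the Gram determinant is still `τ` times a function equal to `δ` on Σ. The cross
term `2sχτ Riem(a,b,z,R)` has no pole, since `P(a,b,z,R) = 0` on Σ. In the quadratic term the factor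
`τ²` meets the pole of `Riem(z,R,z,R)` and leaves `s²χ²τ P(z,R,z,R)` to first order, where
`P(z,R,z,R) = -κ II(z,R)² ≠ 0`. At the centre of the bump the limit therefore moves by `(2sF +
s²P)/δ`, where `F` is the regular part of the cross term, and this is nonzero for a suitable `s`.

Divisions by `τ` come from `exists_smooth_division`; the radical computations are
`cometric_eq_of_division` and `fderiv_form_radical`; the local argument is
`exists_local_modification`. `form_curvature` identifies the intrinsic curvature with the coordinate
formula, and `exists_modification` glues the local change into `M`. -/

noncomputable section

namespace SingularMetric

/-! ### Division of smooth functions by a defining function of a hypersurface. -/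

section Division

open MeasureTheory Set

variable {E : Type*} [NormedAddCommGroup E] [NormedSpace ℝ E]

/-- Integrals of smooth functions over the unit interval depend smoothly on parameters. -/
theorem contDiff_integral_unitInterval {u : E × ℝ → ℝ} (hu : ContDiff ℝ ∞ u) :
    ContDiff ℝ ∞ fun z ↦ ∫ s in (0 : ℝ)..1, u (z, s) := by
  -- The integral is the convolution, evaluated at `0`, of the indicator of `(0,1]` with `t ↦ χ(t)
  -- u(z,-t)`. The cutoff supplies compact support and is harmless, being `1` on the ball of radius
  -- `2`, which contains `[-1,0]`.
  let χ : ContDiffBump (0 : ℝ) := ⟨2, 3, by norm_num, by norm_num⟩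
  have h := contDiffOn_convolution_right_with_param_comp (n := ⊤) (μ := (volume : Measure ℝ))
    (ContinuousLinearMap.lsmul ℝ ℝ) (s := (univ : Set E)) (v := fun _ ↦ (0 : ℝ))
    contDiffOn_const (f := (Ioc (0 : ℝ) 1).indicator fun _ ↦ (1 : ℝ))
    (g := fun z t ↦ χ t • u (z, -t)) (k := Metric.closedBall 0 3) isOpen_univ
    (isCompact_closedBall _ _) ?_ ?_ ?_
  · rw [contDiffOn_univ] at h
    convert h using 2 with z
    rw [convolution_def, intervalIntegral.integral_of_le zero_le_one,
      ← integral_indicator measurableSet_Ioc]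
    congr 1
    ext t
    by_cases ht : t ∈ Ioc (0 : ℝ) 1
    · have : χ (0 - t) = 1 := χ.one_of_mem_closedBall (by
        simp only [zero_sub, Metric.mem_closedBall, dist_zero_right, norm_neg, Real.norm_eq_abs]
        rw [abs_of_pos ht.1]
        exact ht.2.trans (by norm_num [χ]))
      simp [ht] at *
      simp [this]
    · simp [ht]
  · intro z t _ ht
    have : χ t = 0 := χ.zero_of_le_dist (by
      simp only [Metric.mem_closedBall, not_le] at ht
      exact ht.le)
    simp [this]
  · exact (integrable_indicator_iff measurableSet_Ioc |>.2
      (by simp)).locallyIntegrable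
  · refine ContDiff.contDiffOn ?_
    change ContDiff ℝ ∞ fun q : E × ℝ ↦ χ q.2 • u (q.1, -q.2)
    exact (χ.contDiff.comp contDiff_snd).smul
      (hu.comp (contDiff_fst.prodMk contDiff_snd.neg))

/-- A smooth function vanishing on a hyperplane is divisible by the equation of the hyperplane. -/
theorem exists_contDiff_eq_affine_mul {F : E → ℝ} (hF : ContDiff ℝ ∞ F) (ℓ : E →L[ℝ] ℝ) (c : ℝ)
    {v : E} (hv : ℓ v = 1) (h0 : ∀ z, ℓ z + c = 0 → F z = 0) :
    ∃ H : E → ℝ, ContDiff ℝ ∞ H ∧ ∀ z, F z = (ℓ z + c) * H z := by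
  have hF' : ContDiff ℝ ∞ (fderiv ℝ F) := hF.fderiv_right (by simp)
  -- The segment in direction `v` starts at `s = 0` on the hyperplane, where `F` vanishes, and ends
  -- at `z` for `s = 1`; its velocity is `(ℓ z + c) • v`.
  refine ⟨fun z ↦ ∫ s in (0 : ℝ)..1, fderiv ℝ F (z - ((1 - s) * (ℓ z + c)) • v) v, ?_, fun z ↦ ?_⟩
  · refine contDiff_integral_unitInterval
      (u := fun q : E × ℝ ↦ fderiv ℝ F (q.1 - ((1 - q.2) * (ℓ q.1 + c)) • v) v) ?_
    refine (hF'.comp ?_).clm_apply contDiff_const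
    exact contDiff_fst.sub (((contDiff_const.sub contDiff_snd).mul
      ((ℓ.contDiff.comp contDiff_fst).add contDiff_const)).smul contDiff_const)
  · have hd : ∀ s ∈ uIcc (0 : ℝ) 1, HasDerivAt (fun s : ℝ ↦ F (z - ((1 - s) * (ℓ z + c)) • v))
        ((ℓ z + c) * fderiv ℝ F (z - ((1 - s) * (ℓ z + c)) • v) v) s := by
      intro s _
      have h1 : HasDerivAt (fun s : ℝ ↦ z - ((1 - s) * (ℓ z + c)) • v) ((ℓ z + c) • v) s := by
        have := ((((hasDerivAt_id s).const_sub 1).mul_const (ℓ z + c)).smul_const v).const_sub z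
        rw [neg_one_mul, neg_smul, neg_neg] at this
        exact this
      have h2 := ((hF.differentiable (by simp) _).hasFDerivAt).comp_hasDerivAt s h1
      rw [map_smul, smul_eq_mul] at h2
      exact h2
    have := intervalIntegral.integral_eq_sub_of_hasDerivAt hd (by
      apply Continuous.intervalIntegrable
      refine continuous_const.mul ((hF'.continuous.comp ?_).clm_apply continuous_const)
      fun_prop)
    rw [intervalIntegral.integral_const_mul] at this
    rw [this]
    have h3 : F (z - ((1 - (0 : ℝ)) * (ℓ z + c)) • v) = 0 := h0 _ (by simp [hv])
    rw [h3]
    simp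

/-- Multiplying by a bump function extends smooth functions. -/
theorem contDiff_bump_smul [FiniteDimensional ℝ E] {F : Type*} [NormedAddCommGroup F]
    [NormedSpace ℝ F] {y : E} (χ : ContDiffBump y) {V : Set E} (hV : IsOpen V)
    (hχ : Metric.closedBall y χ.rOut ⊆ V) {f : E → F} (hf : ContDiffOn ℝ ∞ f V) :
    ContDiff ℝ ∞ fun x ↦ χ x • f x := by
  rw [contDiff_iff_contDiffAt]
  intro x
  by_cases hx : x ∈ V
  · exact χ.contDiff.contDiffAt.smul (hf.contDiffAt (hV.mem_nhds hx))
  · have : (fun x ↦ χ x • f x) =ᶠ[𝓝 x] fun _ ↦ 0 := by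
      filter_upwards [Metric.isClosed_closedBall.isOpen_compl.mem_nhds (fun h ↦ hx (hχ h))]
        with z hz
      have : χ z = 0 := χ.zero_of_le_dist (by
        simp only [mem_compl_iff, Metric.mem_closedBall, not_le] at hz
        exact hz.le)
      simp [this]
    exact contDiffAt_const.congr_of_eventuallyEq this

/-- Near a regular zero of `τ`, smooth functions vanishing where `τ` does are divisible by `τ`. -/
theorem exists_smooth_division [FiniteDimensional ℝ E] {τ : E → ℝ} {W : Set E} (hW : IsOpen W)
    {y₀ : E} (hy₀ : y₀ ∈ W) (hτ : ContDiffOn ℝ ∞ τ W) (h0 : τ y₀ = 0)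
    (hd : fderiv ℝ τ y₀ ≠ 0) :
    ∃ V ⊆ W, IsOpen V ∧ y₀ ∈ V ∧ ∀ f : E → ℝ, ContDiffOn ℝ ∞ f W →
      (∀ y ∈ W, τ y = 0 → f y = 0) →
      ∃ h : E → ℝ, ContDiffOn ℝ ∞ h V ∧ ∀ y ∈ V, f y = τ y * h y := by
  set ℓ := fderiv ℝ τ y₀ with hℓ
  obtain ⟨v, hv⟩ : ∃ v, ℓ v = 1 := by
    obtain ⟨v, hv⟩ : ∃ v, ℓ v ≠ 0 := by
      by_contra! h
      exact hd (ContinuousLinearMap.ext h)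
    exact ⟨(ℓ v)⁻¹ • v, by simp [hv]⟩
  -- `Φ` straightens `τ`: since `ℓ v = 1`, one has `ℓ (Φ y) - ℓ y₀ = τ y`, and the derivative of `Φ`
  -- at `y₀` is the identity.
  let Φ : E → E := fun y ↦ y + (τ y - ℓ (y - y₀)) • v
  have hτ0 : ContDiffAt ℝ ∞ τ y₀ := hτ.contDiffAt (hW.mem_nhds hy₀)
  have hΦs : ContDiffOn ℝ ∞ Φ W := contDiffOn_id.add ((hτ.sub
    (ℓ.contDiff.comp (contDiff_id.sub contDiff_const)).contDiffOn).smul contDiffOn_const)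
  have hΦ : ContDiffAt ℝ ∞ Φ y₀ := hΦs.contDiffAt (hW.mem_nhds hy₀)
  have hΦ' : HasFDerivAt Φ ((ContinuousLinearEquiv.refl ℝ E : E ≃L[ℝ] E) : E →L[ℝ] E) y₀ := by
    have h1 : HasFDerivAt τ ℓ y₀ := (hτ0.differentiableAt (by simp)).hasFDerivAt
    have h2 : HasFDerivAt (fun y ↦ ℓ (y - y₀)) ℓ y₀ := by
      exact ℓ.hasFDerivAt.comp y₀ ((hasFDerivAt_id y₀).sub_const y₀)
    have h3 := (hasFDerivAt_id y₀).add ((h1.sub h2).smul_const v)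
    have h4 : ((ContinuousLinearEquiv.refl ℝ E : E ≃L[ℝ] E) : E →L[ℝ] E) =
        ContinuousLinearMap.id ℝ E + (ℓ - ℓ).smulRight v := by
      ext x
      simp
    rw [h4]
    exact h3
  let φ := hΦ.toOpenPartialHomeomorph Φ hΦ' (by simp)
  have hφ : (φ : E → E) = Φ := rfl
  have hsrc : y₀ ∈ φ.source := hΦ.mem_toOpenPartialHomeomorph_source hΦ' (by simp)
  have hΦ0 : Φ y₀ = y₀ := by simp [Φ, h0]
  have hloc : ContDiffAt ℝ ∞ φ.symm y₀ := by
    have := hΦ.to_localInverse hΦ' (by simp)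
    rwa [hΦ0] at this
  have htgt : y₀ ∈ φ.target := by
    have := φ.map_source hsrc
    rwa [hφ, hΦ0] at this
  have hsymm0 : φ.symm y₀ = y₀ := by
    have := φ.left_inv hsrc
    rwa [hφ, hΦ0] at this
  -- `ContDiffAt ℝ ∞` at one point only gives, for each finite order, a neighbourhood depending on
  -- that order. A common one is obtained by applying the inverse function theorem at every nearby
  -- point, using that invertible operators form an open set.
  obtain ⟨N, hN, hNc⟩ : ∃ N ∈ 𝓝 y₀, ContDiffOn ℝ ∞ φ.symm N := by
    have hcont : ContinuousAt (fun z ↦ fderiv ℝ Φ (φ.symm z)) y₀ := by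
      refine ContinuousAt.comp (f := φ.symm) (g := fderiv ℝ Φ) ?_ hloc.continuousAt
      rw [hsymm0]
      exact (hΦ.fderiv_right (m := 0) (by simp)).continuousAt
    have hnhds := hcont.preimage_mem_nhds (t := Set.range ((↑) : (E ≃L[ℝ] E) → E →L[ℝ] E)) (by
      rw [hsymm0, hΦ'.fderiv]
      exact ContinuousLinearEquiv.nhds _)
    refine ⟨_, Filter.inter_mem (Filter.inter_mem hnhds (φ.open_target.mem_nhds htgt))
      (hloc.continuousAt.preimage_mem_nhds (t := W) (by rw [hsymm0]; exact hW.mem_nhds hy₀)),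
      fun z hz ↦ ?_⟩
    obtain ⟨⟨⟨e, he⟩, hzt⟩, hzW⟩ := hz
    have hΦz : ContDiffAt ℝ ∞ Φ (φ.symm z) := hΦs.contDiffAt (hW.mem_nhds hzW)
    have hd : HasFDerivAt φ (e : E →L[ℝ] E) (φ.symm z) := by
      rw [he]
      exact (hΦz.differentiableAt (by simp)).hasFDerivAt
    exact (φ.contDiffAt_symm hzt hd hΦz).contDiffWithinAt
  obtain ⟨ε, hε, hball⟩ : ∃ ε > 0, Metric.ball y₀ ε ⊆ N ∩ φ.target ∩ φ.symm ⁻¹' W := by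
    refine Metric.mem_nhds_iff.1 (Filter.inter_mem (Filter.inter_mem hN
      (φ.open_target.mem_nhds htgt)) ?_)
    exact hloc.continuousAt.preimage_mem_nhds (by rw [hsymm0]; exact hW.mem_nhds hy₀)
  -- `χ = 1` on the ball of radius `ε / 3`, whose preimage under `Φ` serves as `V`; hence `V` does
  -- not depend on the function to be divided.
  let χ : ContDiffBump y₀ := ⟨ε / 3, ε / 2, by positivity, by linarith⟩
  have hχ : Metric.closedBall y₀ χ.rOut ⊆ Metric.ball y₀ ε :=
    Metric.closedBall_subset_ball (by simp [χ]; linarith)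
  have hℓτ : ∀ y, ℓ (Φ y) + -ℓ y₀ = τ y := by
    intro y
    simp [Φ, hv]
    ring
  refine ⟨φ.source ∩ φ ⁻¹' Metric.ball y₀ (ε / 3), ?_, φ.isOpen_inter_preimage Metric.isOpen_ball,
    ⟨hsrc, by simp [hφ, hΦ0, hε]⟩, fun f hf hf0 ↦ ?_⟩
  · rintro y ⟨hy, hy'⟩
    have := (hball (Metric.ball_subset_ball (by linarith) hy')).2
    simpa [φ.left_inv hy] using this
  have hV : ∀ y ∈ φ.source ∩ φ ⁻¹' Metric.ball y₀ (ε / 3), y ∈ W := by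
    rintro y ⟨hy, hy'⟩
    have := (hball (Metric.ball_subset_ball (by linarith) hy')).2
    simpa [φ.left_inv hy] using this
  have hF : ContDiff ℝ ∞ fun z ↦ χ z • f (φ.symm z) :=
    contDiff_bump_smul χ Metric.isOpen_ball hχ
      (hf.comp (hNc.mono fun z hz ↦ (hball hz).1.1) fun z hz ↦ (hball hz).2)
  obtain ⟨H, hH, hFH⟩ := exists_contDiff_eq_affine_mul hF ℓ (-ℓ y₀) hv (by
    intro z hz
    by_cases hzb : z ∈ Metric.ball y₀ ε
    · have h1 := hℓτ (φ.symm z)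
      have h2 : Φ (φ.symm z) = z := φ.right_inv (hball hzb).1.2
      rw [h2, hz] at h1
      rw [hf0 _ (hball hzb).2 h1.symm, smul_zero]
    · have : χ z = 0 := χ.zero_of_le_dist (by
        simp only [Metric.mem_ball, not_lt] at hzb
        exact le_trans (by simp [χ]; linarith) hzb)
      simp [this])
  refine ⟨H ∘ Φ, hH.comp_contDiffOn (hΦs.mono hV), fun y hy ↦ ?_⟩
  have h1 := hFH (Φ y)
  rw [hℓτ] at h1
  have h2 : φ.symm (Φ y) = y := φ.left_inv hy.1
  have h3 : χ (Φ y) = 1 := χ.one_of_mem_closedBall (Metric.ball_subset_closedBall hy.2)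
  rw [h2, h3, one_smul] at h1
  exact h1

/-- A continuous function which vanishes off `{τ = 0}` vanishes at the regular zeros of `τ`. -/
theorem eq_zero_of_forall_ne_zero {τ k : E → ℝ} {V : Set E} (hV : IsOpen V)
    (hk : ContinuousOn k V) (h : ∀ z ∈ V, τ z ≠ 0 → k z = 0) {y : E} (hy : y ∈ V)
    (hd : fderiv ℝ τ y ≠ 0) : k y = 0 := by
  obtain ⟨v, hv⟩ : ∃ v, fderiv ℝ τ y v ≠ 0 := by
    by_contra! h
    exact hd (ContinuousLinearMap.ext h)
  have hdiff : DifferentiableAt ℝ τ y := by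
    by_contra hn
    exact hd (fderiv_zero_of_not_differentiableAt hn)
  -- The point is approached along a line transverse to the zero set, on which `τ ≠ 0` at all small
  -- nonzero times.
  have hline : HasDerivAt (fun t : ℝ ↦ y + t • v) v 0 := by
    simpa using ((hasDerivAt_id (0 : ℝ)).smul_const v).const_add y
  have hder : HasDerivAt (fun t : ℝ ↦ τ (y + t • v)) (fderiv ℝ τ y v) 0 := by
    have h1 : HasFDerivAt τ (fderiv ℝ τ y) (y + (0 : ℝ) • v) := by simpa using hdiff.hasFDerivAt
    exact h1.comp_hasDerivAt (0 : ℝ) hline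
  have hcont : Filter.Tendsto (fun t : ℝ ↦ y + t • v) (𝓝[≠] 0) (𝓝 y) := by
    have := hline.continuousAt.tendsto
    simp only [zero_smul, add_zero] at this
    exact this.mono_left nhdsWithin_le_nhds
  have hne := hder.eventually_ne hv (c := 0)
  have hkt : Filter.Tendsto (fun t : ℝ ↦ k (y + t • v)) (𝓝[≠] 0) (𝓝 (k y)) :=
    (hk.continuousAt (hV.mem_nhds hy)).tendsto.comp hcont
  refine tendsto_nhds_unique (hkt.congr' ?_) tendsto_const_nhds
  filter_upwards [hne, hcont (hV.mem_nhds hy)] with t ht htV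
  exact h _ htV ht

end Division

/-! ### The curvature tensor in coordinates, its smooth constituents and its symmetries. -/

section CoordinateCurvature

open Matrix

set_option maxSynthPendingDepth 3

variable {m : ℕ}

/-- The coordinate space on which the manifold is modelled. -/
abbrev Coord (m : ℕ) : Type := EuclideanSpace ℝ (Fin m)

/-- A field of bilinear forms on the coordinate space. -/
abbrev CoordForm (m : ℕ) : Type := Coord m → Coord m →L[ℝ] Coord m →L[ℝ] ℝ

/-- The standard basis vectors of the coordinate space. -/
abbrev unitVec (i : Fin m) : Coord m := EuclideanSpace.single i (1 : ℝ)

theorem sum_smul_unitVec (v : Coord m) : ∑ i, v i • unitVec i = v := by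
  have := (EuclideanSpace.basisFun (Fin m) ℝ).sum_repr v
  simpa using this

/-- The Christoffel symbols of the first kind, as a function of three vectors. -/
def christoffel (G : CoordForm m) (y a b c : Coord m) : ℝ :=
  (1 / 2) * (fderiv ℝ G y a b c + fderiv ℝ G y b c a - fderiv ℝ G y c a b)

/-- The components of the covector `christoffel G y a b`. -/
def christoffelVec (G : CoordForm m) (y a b : Coord m) : Fin m → ℝ :=
  fun i ↦ christoffel G y a b (unitVec i)

/-- The matrix of `G` in the standard basis. -/
def gramMatrix (G : CoordForm m) (y : Coord m) : Matrix (Fin m) (Fin m) ℝ :=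
  Matrix.of fun i j ↦ G y (unitVec i) (unitVec j)

/-- The determinant of `G` in the standard basis. -/
def metricDet (G : CoordForm m) (y : Coord m) : ℝ := (gramMatrix G y).det

/-- The bilinear form on covectors given by the adjugate of the matrix of `G`. -/
def cometric (G : CoordForm m) (y : Coord m) (ξ η : Fin m → ℝ) : ℝ :=
  ξ ⬝ᵥ (gramMatrix G y).adjugate *ᵥ η

/-- The part of the curvature tensor which is linear in the second derivatives of the metric. -/
def hessianPart (G : CoordForm m) (y a b c d : Coord m) : ℝ :=
  (1 / 2) * (fderiv ℝ (fderiv ℝ G) y a c d b - fderiv ℝ (fderiv ℝ G) y a d b c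
    - fderiv ℝ (fderiv ℝ G) y b c d a + fderiv ℝ (fderiv ℝ G) y b d a c)

/-- The part of the curvature tensor which is quadratic in the Christoffel symbols, multiplied by
the determinant of the metric. -/
def polarPart (G : CoordForm m) (y a b c d : Coord m) : ℝ :=
  cometric G y (christoffelVec G y b d) (christoffelVec G y a c)
    - cometric G y (christoffelVec G y a d) (christoffelVec G y b c)

/-- The curvature tensor `⟨R(a,b)c,d⟩` in coordinates. -/
def riem (G : CoordForm m) (y a b c d : Coord m) : ℝ :=
  hessianPart G y a b c d + (metricDet G y)⁻¹ * polarPart G y a b c d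

/-- The bilinear form induced by `G` on bivectors. -/
def areaForm (G : CoordForm m) (y a b c d : Coord m) : ℝ :=
  G y a c * G y b d - G y a d * G y b c

/-! ### Smoothness -/

section Smoothness

variable {G : CoordForm m} {W : Set (Coord m)} {a b c d : Coord m → Coord m}

theorem contDiffOn_form_apply (hG : ContDiffOn ℝ ∞ G W) (ha : ContDiffOn ℝ ∞ a W)
    (hb : ContDiffOn ℝ ∞ b W) : ContDiffOn ℝ ∞ (fun y ↦ G y (a y) (b y)) W :=
  (hG.clm_apply ha).clm_apply hb

theorem contDiffOn_christoffel (hW : IsOpen W) (hG : ContDiffOn ℝ ∞ G W)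
    (ha : ContDiffOn ℝ ∞ a W) (hb : ContDiffOn ℝ ∞ b W) (hc : ContDiffOn ℝ ∞ c W) :
    ContDiffOn ℝ ∞ (fun y ↦ christoffel G y (a y) (b y) (c y)) W := by
  have hG' : ContDiffOn ℝ ∞ (fderiv ℝ G) W := hG.fderiv_of_isOpen hW (by simp)
  exact contDiffOn_const.mul (((((hG'.clm_apply ha).clm_apply hb).clm_apply hc).add
    (((hG'.clm_apply hb).clm_apply hc).clm_apply ha)).sub
    (((hG'.clm_apply hc).clm_apply ha).clm_apply hb))

theorem contDiffOn_matrix_det {n : ℕ} {A : Coord m → Matrix (Fin n) (Fin n) ℝ}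
    (hA : ∀ i j, ContDiffOn ℝ ∞ (fun y ↦ A y i j) W) : ContDiffOn ℝ ∞ (fun y ↦ (A y).det) W := by
  simp only [Matrix.det_apply']
  exact ContDiffOn.sum fun σ _ ↦ contDiffOn_const.mul (contDiffOn_prod fun i _ ↦ hA _ _)

theorem contDiffOn_gramMatrix (hG : ContDiffOn ℝ ∞ G W) (i j : Fin m) :
    ContDiffOn ℝ ∞ (fun y ↦ gramMatrix G y i j) W :=
  contDiffOn_form_apply hG contDiffOn_const contDiffOn_const

theorem contDiffOn_metricDet (hG : ContDiffOn ℝ ∞ G W) : ContDiffOn ℝ ∞ (metricDet G) W :=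
  contDiffOn_matrix_det fun i j ↦ contDiffOn_gramMatrix hG i j

theorem contDiffOn_adjugate (hG : ContDiffOn ℝ ∞ G W) (i j : Fin m) :
    ContDiffOn ℝ ∞ (fun y ↦ (gramMatrix G y).adjugate i j) W := by
  simp only [Matrix.adjugate_apply]
  refine contDiffOn_matrix_det fun k l ↦ ?_
  by_cases hk : k = j
  · subst hk
    simpa using contDiffOn_const
  · simpa [Matrix.updateRow_ne hk] using contDiffOn_gramMatrix hG k l

theorem contDiffOn_cometric (hG : ContDiffOn ℝ ∞ G W) {ξ η : Coord m → Fin m → ℝ}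
    (hξ : ∀ i, ContDiffOn ℝ ∞ (fun y ↦ ξ y i) W) (hη : ∀ i, ContDiffOn ℝ ∞ (fun y ↦ η y i) W) :
    ContDiffOn ℝ ∞ (fun y ↦ cometric G y (ξ y) (η y)) W := by
  simp only [cometric, dotProduct, mulVec]
  exact ContDiffOn.sum fun i _ ↦ (hξ i).mul
    (ContDiffOn.sum fun j _ ↦ (contDiffOn_adjugate hG i j).mul (hη j))

theorem contDiffOn_polarPart (hW : IsOpen W) (hG : ContDiffOn ℝ ∞ G W)
    (ha : ContDiffOn ℝ ∞ a W) (hb : ContDiffOn ℝ ∞ b W) (hc : ContDiffOn ℝ ∞ c W)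
    (hd : ContDiffOn ℝ ∞ d W) :
    ContDiffOn ℝ ∞ (fun y ↦ polarPart G y (a y) (b y) (c y) (d y)) W :=
  (contDiffOn_cometric hG (fun _ ↦ contDiffOn_christoffel hW hG hb hd contDiffOn_const)
    fun _ ↦ contDiffOn_christoffel hW hG ha hc contDiffOn_const).sub
  (contDiffOn_cometric hG (fun _ ↦ contDiffOn_christoffel hW hG ha hd contDiffOn_const)
    fun _ ↦ contDiffOn_christoffel hW hG hb hc contDiffOn_const)

theorem contDiffOn_hessianPart (hW : IsOpen W) (hG : ContDiffOn ℝ ∞ G W)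
    (ha : ContDiffOn ℝ ∞ a W) (hb : ContDiffOn ℝ ∞ b W) (hc : ContDiffOn ℝ ∞ c W)
    (hd : ContDiffOn ℝ ∞ d W) :
    ContDiffOn ℝ ∞ (fun y ↦ hessianPart G y (a y) (b y) (c y) (d y)) W := by
  have hG' : ContDiffOn ℝ ∞ (fderiv ℝ G) W := hG.fderiv_of_isOpen hW (by simp)
  have hG'' : ContDiffOn ℝ ∞ (fderiv ℝ (fderiv ℝ G)) W := hG'.fderiv_of_isOpen hW (by simp)
  exact contDiffOn_const.mul ((((
    (((hG''.clm_apply ha).clm_apply hc).clm_apply hd).clm_apply hb).sub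
    ((((hG''.clm_apply ha).clm_apply hd).clm_apply hb).clm_apply hc)).sub
    ((((hG''.clm_apply hb).clm_apply hc).clm_apply hd).clm_apply ha)).add
    ((((hG''.clm_apply hb).clm_apply hd).clm_apply ha).clm_apply hc))

theorem contDiffOn_areaForm (hG : ContDiffOn ℝ ∞ G W)
    (ha : ContDiffOn ℝ ∞ a W) (hb : ContDiffOn ℝ ∞ b W) (hc : ContDiffOn ℝ ∞ c W)
    (hd : ContDiffOn ℝ ∞ d W) :
    ContDiffOn ℝ ∞ (fun y ↦ areaForm G y (a y) (b y) (c y) (d y)) W :=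
  ((contDiffOn_form_apply hG ha hc).mul (contDiffOn_form_apply hG hb hd)).sub
    ((contDiffOn_form_apply hG ha hd).mul (contDiffOn_form_apply hG hb hc))

end Smoothness

/-! ### Algebraic symmetries -/

section Symmetries

variable {G : CoordForm m} {y : Coord m}

theorem fderiv_form_symm (hsymm : ∀ᶠ x in 𝓝 y, ∀ v w, G x v w = G x w v)
    (hG : DifferentiableAt ℝ G y) (a b c : Coord m) :
    fderiv ℝ G y a b c = fderiv ℝ G y a c b := by
  have h (b c : Coord m) := (hG.hasFDerivAt.clm_apply (hasFDerivAt_const b y)).clm_apply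
    (hasFDerivAt_const c y)
  have h3 : (fun x ↦ G x b c) =ᶠ[𝓝 y] fun x ↦ G x c b := by
    filter_upwards [hsymm] with x hx using hx b c
  have := DFunLike.congr_fun (((h b c).congr_of_eventuallyEq h3.symm).unique (h c b)) a
  simpa using this

theorem christoffel_comm (hsymm : ∀ a b c, fderiv ℝ G y a b c = fderiv ℝ G y a c b)
    (a b c : Coord m) : christoffel G y a b c = christoffel G y b a c := by
  simp only [christoffel]
  rw [hsymm c a b, hsymm a c b, hsymm b a c]
  ring

theorem christoffelVec_comm (hsymm : ∀ a b c, fderiv ℝ G y a b c = fderiv ℝ G y a c b)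
    (a b : Coord m) : christoffelVec G y a b = christoffelVec G y b a :=
  funext fun _ ↦ christoffel_comm hsymm _ _ _

theorem christoffelVec_add (a a' b : Coord m) :
    christoffelVec G y (a + a') b = christoffelVec G y a b + christoffelVec G y a' b := by
  ext i
  simp only [christoffelVec, christoffel, map_add, _root_.add_apply, Pi.add_apply]
  ring

theorem christoffelVec_smul (t : ℝ) (a b : Coord m) :
    christoffelVec G y (t • a) b = t • christoffelVec G y a b := by
  ext i
  simp only [christoffelVec, christoffel, map_smul, _root_.smul_apply, Pi.smul_apply,
    smul_eq_mul]
  ring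

theorem dotProduct_christoffelVec (a b v : Coord m) :
    (christoffelVec G y a b) ⬝ᵥ (v : Fin m → ℝ) = christoffel G y a b v := by
  have h : christoffel G y a b v = christoffel G y a b (∑ i, v i • unitVec i) := by
    rw [sum_smul_unitVec]
  rw [h]
  simp only [christoffel, christoffelVec, dotProduct, map_sum, map_smul,
    _root_.sum_apply, _root_.smul_apply, smul_eq_mul]
  rw [← Finset.sum_add_distrib, ← Finset.sum_sub_distrib, Finset.mul_sum]
  exact Finset.sum_congr rfl fun i _ ↦ by ring

theorem gramMatrix_transpose (hsymm : ∀ v w, G y v w = G y w v) :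
    (gramMatrix G y)ᵀ = gramMatrix G y := by
  ext i j
  exact hsymm _ _

theorem adjugate_transpose (hsymm : ∀ v w, G y v w = G y w v) :
    ((gramMatrix G y).adjugate)ᵀ = (gramMatrix G y).adjugate := by
  rw [Matrix.adjugate_transpose, gramMatrix_transpose hsymm]

theorem cometric_comm (hsymm : ∀ v w, G y v w = G y w v) (ξ η : Fin m → ℝ) :
    cometric G y ξ η = cometric G y η ξ := by
  rw [cometric, cometric, Matrix.dotProduct_mulVec, ← Matrix.mulVec_transpose,
    adjugate_transpose hsymm, dotProduct_comm]

theorem cometric_add_left (ξ ξ' η : Fin m → ℝ) :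
    cometric G y (ξ + ξ') η = cometric G y ξ η + cometric G y ξ' η := add_dotProduct _ _ _

theorem cometric_smul_left (t : ℝ) (ξ η : Fin m → ℝ) :
    cometric G y (t • ξ) η = t * cometric G y ξ η := smul_dotProduct _ _ _

theorem cometric_add_right (ξ η η' : Fin m → ℝ) :
    cometric G y ξ (η + η') = cometric G y ξ η + cometric G y ξ η' := by
  simp [cometric, mulVec_add]

theorem cometric_smul_right (t : ℝ) (ξ η : Fin m → ℝ) :
    cometric G y ξ (t • η) = t * cometric G y ξ η := by
  simp [cometric, mulVec_smul]

theorem riem_add_left (a a' b c d : Coord m) :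
    riem G y (a + a') b c d = riem G y a b c d + riem G y a' b c d := by
  simp only [riem, hessianPart, polarPart, christoffelVec_add, cometric_add_left,
    cometric_add_right, map_add, _root_.add_apply]
  ring

theorem riem_smul_left (t : ℝ) (a b c d : Coord m) :
    riem G y (t • a) b c d = t * riem G y a b c d := by
  simp only [riem, hessianPart, polarPart, christoffelVec_smul, cometric_smul_left,
    cometric_smul_right, map_smul, _root_.smul_apply, smul_eq_mul]
  ring

theorem riem_swap_left (hsymm : ∀ v w, G y v w = G y w v) (a b c d : Coord m) :
    riem G y a b c d = -riem G y b a c d := by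
  simp only [riem, hessianPart, polarPart]
  rw [cometric_comm hsymm (christoffelVec G y b d), cometric_comm hsymm (christoffelVec G y a d)]
  ring

/-- With antisymmetry in the first pair, this makes the curvature a quadratic form on bivectors,
which is all that is used of it; the Bianchi identity plays no part. -/
theorem riem_pair_symm (hsymm : ∀ v w, G y v w = G y w v)
    (hsymm' : ∀ a b c, fderiv ℝ G y a b c = fderiv ℝ G y a c b)
    (hsymm₂ : ∀ a b c d, fderiv ℝ (fderiv ℝ G) y a b c d = fderiv ℝ (fderiv ℝ G) y a b d c)
    (hsymm₃ : ∀ a b, fderiv ℝ (fderiv ℝ G) y a b = fderiv ℝ (fderiv ℝ G) y b a)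
    (a b c d : Coord m) : riem G y a b c d = riem G y c d a b := by
  simp only [riem, hessianPart, polarPart]
  rw [hsymm₃ c a, hsymm₃ c b, hsymm₃ d a, hsymm₃ d b, hsymm₂ a c b d, hsymm₂ b c d a,
    hsymm₂ a d b c, hsymm₂ b d c a, christoffelVec_comm hsymm' d b, christoffelVec_comm hsymm' c a,
    christoffelVec_comm hsymm' c b, christoffelVec_comm hsymm' d a,
    cometric_comm hsymm (christoffelVec G y b c)]
  ring

/-- The effect on a form with the symmetries of a curvature tensor of changing the bivector
`a ∧ b` by a multiple of `z ∧ (α a + β b)`. -/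
theorem curvatureLike_change {V : Type*} [AddCommGroup V] [Module ℝ V]
    (f : V → V → V → V → ℝ) (hadd : ∀ a a' b c d, f (a + a') b c d = f a b c d + f a' b c d)
    (hsmul : ∀ (t : ℝ) a b c d, f (t • a) b c d = t * f a b c d)
    (hswap : ∀ a b c d, f a b c d = -f b a c d) (hpair : ∀ a b c d, f a b c d = f c d a b)
    (a b z : V) (α β x : ℝ) :
    f (a + (x * β) • z) (b + (-(x * α)) • z) (a + (x * β) • z) (b + (-(x * α)) • z) =
      f a b a b + 2 * x * f a b z (α • a + β • b)
        + x ^ 2 * f z (α • a + β • b) z (α • a + β • b) := by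
  have hadd2 : ∀ a b b' c d, f a (b + b') c d = f a b c d + f a b' c d := by
    intro a b b' c d
    rw [hswap, hadd, hswap b, hswap b']
    ring
  have hsmul2 : ∀ (t : ℝ) a b c d, f a (t • b) c d = t * f a b c d := by
    intro t a b c d
    rw [hswap, hsmul, hswap b]
    ring
  have hself : ∀ z c d, f z z c d = 0 := fun z c d ↦ by linarith [hswap z z c d]
  -- As bivectors, `(a + xβ z) ∧ (b - xα z) = a ∧ b + x z ∧ (αa + βb)`. Pair symmetry lets the same
  -- identity be used in the last two slots.
  have key : ∀ c d, f (a + (x * β) • z) (b + (-(x * α)) • z) c d =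
      f a b c d + x * f z (α • a + β • b) c d := by
    intro c d
    simp only [hadd, hadd2, hsmul, hsmul2, hself]
    rw [hswap a z]
    ring
  rw [key, hpair a b, hpair z, key, key, hpair z _ a b, hpair z _ z]
  ring

end Symmetries

end CoordinateCurvature

/-! ### The radical line: smooth generator, normalization, first derivatives. -/

section RadicalFrame

open Matrix

set_option maxSynthPendingDepth 3

variable {m : ℕ}

/-- Cancellation of a function with regular zeros. -/
theorem eq_of_mul_eq_mul_of_regular {E : Type*} [NormedAddCommGroup E] [NormedSpace ℝ E]
    {τ f g : E → ℝ} {V : Set E} (hV : IsOpen V) (hf : ContinuousOn f V) (hg : ContinuousOn g V)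
    (hd : ∀ y ∈ V, τ y = 0 → fderiv ℝ τ y ≠ 0) (h : ∀ y ∈ V, τ y * f y = τ y * g y) :
    ∀ y ∈ V, f y = g y := by
  intro y hy
  by_cases h0 : τ y = 0
  · refine sub_eq_zero.1 (eq_zero_of_forall_ne_zero (k := fun z ↦ f z - g z) hV (hf.sub hg) ?_ hy
      (hd y hy h0))
    intro z hz hz0
    exact sub_eq_zero.2 (mul_left_cancel₀ hz0 (h z hz))
  · exact mul_left_cancel₀ h0 (h y hy)

section Pointwise

variable {V : Type*} [AddCommGroup V] [Module ℝ V]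

/-- When `g a a ≠ 0`, the vectors of the plane orthogonal to `a` form the line through `-g(a,b) a +
g(a,a) b`, and a radical vector lies on it. The coefficients are smooth in `a`, `b` and `g`, which
gives a smooth generator of the radical. -/
theorem radical_combination {g : V → V → ℝ}
    (hadd : ∀ u v w, g (u + v) w = g u w + g v w) (hsmul : ∀ (t : ℝ) u w, g (t • u) w = t * g u w)
    (hsymm : ∀ u v, g u v = g v u) {a b : V} (haa : g a a ≠ 0) {v : V} (hv : v ≠ 0)
    (hg : ∀ w, g v w = 0) (hspan : v ∈ Submodule.span ℝ {a, b}) :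
    ∃ t : ℝ, t ≠ 0 ∧ (-g a b) • a + (g a a) • b = t • v := by
  obtain ⟨p, q, rfl⟩ := Submodule.mem_span_pair.1 hspan
  have h1 := hg a
  rw [hadd, hsmul, hsmul, hsymm b a] at h1
  have hq : q ≠ 0 := by
    rintro rfl
    have hp : p = 0 := by simpa [haa] using h1
    simp [hp] at hv
  refine ⟨g a a / q, div_ne_zero haa hq, ?_⟩
  rw [smul_add, smul_smul, smul_smul, div_mul_cancel₀ _ hq]
  congr 2
  field_simp
  linarith

end Pointwise

variable {G : CoordForm m}

theorem form_eq_dotProduct (y v w : Coord m) :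
    G y v w = (v : Fin m → ℝ) ⬝ᵥ gramMatrix G y *ᵥ (w : Fin m → ℝ) := by
  have h : G y v w = G y (∑ i, v i • unitVec i) (∑ i, w i • unitVec i) := by
    rw [sum_smul_unitVec, sum_smul_unitVec]
  rw [h]
  simp only [map_sum, map_smul, _root_.sum_apply, _root_.smul_apply, smul_eq_mul, dotProduct,
    mulVec, gramMatrix, Matrix.of_apply]
  simp only [Finset.mul_sum]
  rw [Finset.sum_comm]
  exact Finset.sum_congr rfl fun i _ ↦ Finset.sum_congr rfl fun j _ ↦ by ring

theorem form_eq_zero_iff {y : Coord m} (hsymm : ∀ v w, G y v w = G y w v) (v : Coord m) :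
    G y v = 0 ↔ gramMatrix G y *ᵥ (v : Fin m → ℝ) = 0 := by
  constructor
  · intro h
    ext i
    have := form_eq_dotProduct (G := G) y (unitVec i) v
    rw [hsymm, h] at this
    simpa using this.symm
  · intro h
    ext w
    rw [hsymm, form_eq_dotProduct, h]
    simp

theorem exists_radical_ne_zero {y : Coord m} (hsymm : ∀ v w, G y v w = G y w v)
    (h : metricDet G y = 0) : ∃ v, v ≠ 0 ∧ G y v = 0 := by
  obtain ⟨v, hv, h0⟩ := Matrix.exists_mulVec_eq_zero_iff.2 h
  refine ⟨WithLp.toLp 2 v, ?_, (form_eq_zero_iff hsymm _).2 h0⟩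
  intro h
  exact hv (by simpa using congrArg WithLp.ofLp h)

theorem metricDet_eq_zero_iff {y : Coord m} (hsymm : ∀ v w, G y v w = G y w v) :
    metricDet G y = 0 ↔ ∃ v, v ≠ 0 ∧ G y v = 0 := by
  refine ⟨exists_radical_ne_zero hsymm, fun ⟨v, hv, h0⟩ ↦ ?_⟩
  refine Matrix.exists_mulVec_eq_zero_iff.1 ⟨v, ?_, (form_eq_zero_iff hsymm _).1 h0⟩
  intro h
  exact hv (by ext i; simpa using congrFun h i)

/-- Where the gram matrix of `a, b` has rank one and the plane of `a, b` contains the radical, the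
radical is spanned by a smooth combination of `a` and `b`. -/
theorem exists_radical_combination {W : Set (Coord m)} (hW : IsOpen W) {y₀ : Coord m}
    (hy₀ : y₀ ∈ W) (hτ : metricDet G y₀ = 0) (hG : ContDiffOn ℝ ∞ G W)
    {a b : Coord m → Coord m} (ha : ContDiffOn ℝ ∞ a W) (hb : ContDiffOn ℝ ∞ b W)
    (hsymm : ∀ y ∈ W, ∀ v w, G y v w = G y w v)
    (hrk : ∀ y ∈ W, metricDet G y = 0 → ¬ (G y (a y) (a y) = 0 ∧ G y (b y) (b y) = 0))
    (hrad : ∀ y ∈ W, metricDet G y = 0 → ∀ v, G y v = 0 →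
      v ∈ Submodule.span ℝ {a y, b y}) :
    ∃ W' ⊆ W, IsOpen W' ∧ y₀ ∈ W' ∧ ∃ α β : Coord m → ℝ, ContDiffOn ℝ ∞ α W' ∧
      ContDiffOn ℝ ∞ β W' ∧ ∀ y ∈ W', metricDet G y = 0 →
        G y (α y • a y + β y • b y) = 0 ∧ α y • a y + β y • b y ≠ 0 ∧
          ∀ v, G y v = 0 → ∃ t : ℝ, v = t • (α y • a y + β y • b y) := by
  -- At least one of `a`, `b` has nonzero square at `y₀`; this treats the case of `a`, and the other
  -- follows by exchanging the two.
  have key : ∀ a b : Coord m → Coord m, ContDiffOn ℝ ∞ a W → ContDiffOn ℝ ∞ b W →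
      G y₀ (a y₀) (a y₀) ≠ 0 → (∀ y ∈ W, metricDet G y = 0 → ∀ v, G y v = 0 →
      v ∈ Submodule.span ℝ {a y, b y}) → 
      ∃ W' ⊆ W, IsOpen W' ∧ y₀ ∈ W' ∧ ∃ α β : Coord m → ℝ, ContDiffOn ℝ ∞ α W' ∧
      ContDiffOn ℝ ∞ β W' ∧ ∀ y ∈ W', metricDet G y = 0 →
        G y (α y • a y + β y • b y) = 0 ∧ α y • a y + β y • b y ≠ 0 ∧
          ∀ v, G y v = 0 → ∃ t : ℝ, v = t • (α y • a y + β y • b y) := by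
    intro a b ha hb h0 hrad
    have hc := contDiffOn_form_apply hG ha ha
    have hsub : W ∩ (fun y ↦ G y (a y) (a y)) ⁻¹' {0}ᶜ ⊆ W := Set.inter_subset_left
    refine ⟨_, hsub, hc.continuousOn.isOpen_inter_preimage hW isOpen_compl_singleton, ⟨hy₀, h0⟩,
      fun y ↦ -G y (a y) (b y), fun y ↦ G y (a y) (a y),
      ((contDiffOn_form_apply hG ha hb).neg).mono hsub, hc.mono hsub, ?_⟩
    rintro y ⟨hy, hay⟩ hτy
    have hrc (v : Coord m) (hv : v ≠ 0) (hv0 : G y v = 0) := radical_combination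
      (g := fun v w ↦ G y v w) (by simp) (by simp) (hsymm y hy) hay hv (by simp [hv0])
      (hrad y hy hτy v hv0)
    obtain ⟨v, hv, hv0⟩ := exists_radical_ne_zero (hsymm y hy) hτy
    obtain ⟨t, ht, he⟩ := hrc v hv hv0
    refine ⟨?_, ?_, fun v hv0 ↦ ?_⟩
    · rw [he, map_smul, hv0, smul_zero]
    · rw [he]
      exact smul_ne_zero ht hv
    · by_cases hv : v = 0
      · exact ⟨0, by simp [hv]⟩
      · obtain ⟨t, ht, he⟩ := hrc v hv hv0
        exact ⟨t⁻¹, by rw [he, smul_smul, inv_mul_cancel₀ ht, one_smul]⟩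
  by_cases h0 : G y₀ (a y₀) (a y₀) = 0
  · have h1 : G y₀ (b y₀) (b y₀) ≠ 0 := fun h ↦ hrk y₀ hy₀ hτ ⟨h0, h⟩
    obtain ⟨W', hW', ho, hy, α, β, hα, hβ, h⟩ := key b a hb ha h1 (by
      intro y hy hτ v hv
      rw [Set.pair_comm]
      exact hrad y hy hτ v hv)
    exact ⟨W', hW', ho, hy, β, α, hβ, hα, fun y hy hτ ↦ by simpa only [add_comm] using h y hy hτ⟩
  · exact key a b ha hb h0 hrad

/-- On a one-dimensional radical, the adjugate of the metric has rank one. -/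
theorem exists_cometric_eq {y R : Coord m} (hsymm : ∀ v w, G y v w = G y w v)
    (hτ : metricDet G y = 0) (hR : R ≠ 0)
    (hker : ∀ v, G y v = 0 → ∃ t : ℝ, v = t • R) :
    ∃ c : ℝ, ∀ ξ η : Fin m → ℝ, cometric G y ξ η = c * (ξ ⬝ᵥ (R : Fin m → ℝ)) *
      (η ⬝ᵥ (R : Fin m → ℝ)) := by
  -- `g · adj g = τ = 0`, so the adjugate takes values in the kernel, the line of `R`. Its symmetry
  -- then makes the coefficient `t η` proportional to `η ⬝ᵥ R`.
  have h1 (η : Fin m → ℝ) : ∃ t : ℝ, (gramMatrix G y).adjugate *ᵥ η = t • (R : Fin m → ℝ) := by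
    obtain ⟨t, ht⟩ := hker (WithLp.toLp 2 ((gramMatrix G y).adjugate *ᵥ η)) (by
      rw [form_eq_zero_iff hsymm]
      change gramMatrix G y *ᵥ ((gramMatrix G y).adjugate *ᵥ η) = 0
      rw [mulVec_mulVec, mul_adjugate]
      change (metricDet G y • (1 : Matrix (Fin m) (Fin m) ℝ)) *ᵥ η = 0
      simp [hτ])
    exact ⟨t, congrArg WithLp.ofLp ht⟩
  choose t ht using h1
  have h2 (ξ η : Fin m → ℝ) : cometric G y ξ η = t η * (ξ ⬝ᵥ (R : Fin m → ℝ)) := by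
    rw [cometric, ht, dotProduct_smul, smul_eq_mul]
  have hRR : (R : Fin m → ℝ) ⬝ᵥ (R : Fin m → ℝ) ≠ 0 := by
    rw [Ne, dotProduct_self_eq_zero]
    intro h
    exact hR (by ext i; simpa using congrFun h i)
  refine ⟨t R / ((R : Fin m → ℝ) ⬝ᵥ (R : Fin m → ℝ)), fun ξ η ↦ ?_⟩
  have h3 := cometric_comm hsymm (R : Fin m → ℝ) η
  rw [h2, h2] at h3
  rw [h2]
  field_simp
  rw [mul_right_comm, h3]
  ring

/-- The normalization of the radical: if `⟨R, ·⟩ = τ w` near a regular zero of `τ = det g`, then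
`adj g = (w R)⁻¹ R ⊗ R` at that zero. -/
theorem cometric_eq_of_division {V : Set (Coord m)} (hV : IsOpen V) (hG : ContDiffOn ℝ ∞ G V)
    (hsymm : ∀ y ∈ V, ∀ v w, G y v w = G y w v)
    (hd : ∀ y ∈ V, metricDet G y = 0 → fderiv ℝ (metricDet G) y ≠ 0)
    {R : Coord m → Coord m} (hR : ContDiffOn ℝ ∞ R V) {w : Coord m → Fin m → ℝ}
    (hw : ∀ i, ContDiffOn ℝ ∞ (fun y ↦ w y i) V)
    (hRw : ∀ y ∈ V, ∀ v, G y (R y) v = metricDet G y * (w y ⬝ᵥ (v : Fin m → ℝ)))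
    (hker : ∀ y ∈ V, metricDet G y = 0 → R y ≠ 0 ∧
      ∀ v, G y v = 0 → ∃ t : ℝ, v = t • R y)
    {y : Coord m} (hy : y ∈ V) (hτ : metricDet G y = 0) :
    ∃ c : ℝ, c * (w y ⬝ᵥ (R y : Fin m → ℝ)) = 1 ∧
      ∀ ξ η : Fin m → ℝ, cometric G y ξ η = c * (ξ ⬝ᵥ (R y : Fin m → ℝ)) *
        (η ⬝ᵥ (R y : Fin m → ℝ)) := by
  -- Applying the adjugate to `g R = τ w` gives `τ R = τ (adj g) w`; cancelling `τ` yields `R = (adj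
  -- g) w` even on the singular set.
  have hRi (i : Fin m) : ∀ y ∈ V, R y i = ((gramMatrix G y).adjugate *ᵥ w y) i := by
    have hRi' : ContDiffOn ℝ ∞ (fun y ↦ R y i) V := by
      exact (EuclideanSpace.proj (𝕜 := ℝ) i).contDiff.comp_contDiffOn hR
    refine eq_of_mul_eq_mul_of_regular hV hRi'.continuousOn ?_ hd ?_
    · simp only [mulVec, dotProduct]
      exact (ContDiffOn.sum fun j _ ↦ (contDiffOn_adjugate hG i j).mul (hw j)).continuousOn
    · intro z hz
      have h1 : gramMatrix G z *ᵥ (R z : Fin m → ℝ) = metricDet G z • w z := by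
        ext j
        have := form_eq_dotProduct (G := G) z (unitVec j) (R z)
        rw [hsymm z hz, hRw z hz] at this
        simpa using this.symm
      have h2 := congrArg (fun u ↦ ((gramMatrix G z).adjugate *ᵥ u) i) h1
      simp only [mulVec_mulVec, adjugate_mul, mulVec_smul] at h2
      rw [smul_mulVec, one_mulVec] at h2
      exact h2
  obtain ⟨hR0, hk⟩ := hker y hy hτ
  obtain ⟨c, hc⟩ := exists_cometric_eq (hsymm y hy) hτ hR0 hk
  refine ⟨c, ?_, hc⟩
  -- Pairing `R = (adj g) w` with `R` gives `R·R = c (R·R)(w·R)`, hence `c (w·R) = 1`.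
  have h1 := hc (R y) (w y)
  rw [cometric, ← funext fun i ↦ hRi i y hy] at h1
  have hRR : (R y : Fin m → ℝ) ⬝ᵥ (R y : Fin m → ℝ) ≠ 0 := by
    rw [Ne, dotProduct_self_eq_zero]
    intro h
    exact hR0 (by ext i; simpa using congrFun h i)
  refine mul_left_cancel₀ hRR ?_
  rw [mul_one]
  conv_rhs => rw [h1]
  ring

/-- The derivative of the metric on the radical is proportional to the derivative of `det g`. -/
theorem fderiv_form_radical {V : Set (Coord m)} (hV : IsOpen V) (hG : ContDiffOn ℝ ∞ G V)
    (hsymm : ∀ y ∈ V, ∀ v w, G y v w = G y w v)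
    {R : Coord m → Coord m} (hR : ContDiffOn ℝ ∞ R V) {w : Coord m → Fin m → ℝ}
    (hw : ∀ i, ContDiffOn ℝ ∞ (fun y ↦ w y i) V)
    (hRw : ∀ y ∈ V, ∀ v, G y (R y) v = metricDet G y * (w y ⬝ᵥ (v : Fin m → ℝ)))
    {y : Coord m} (hy : y ∈ V) (hτ : metricDet G y = 0) (x : Coord m) :
    fderiv ℝ G y x (R y) (R y) =
      (w y ⬝ᵥ (R y : Fin m → ℝ)) * fderiv ℝ (metricDet G) y x := by
  have hn := hV.mem_nhds hy
  have dG := ((hG.contDiffAt hn).differentiableAt (by simp)).hasFDerivAt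
  have dR := ((hR.contDiffAt hn).differentiableAt (by simp)).hasFDerivAt
  have dτ := (((contDiffOn_metricDet hG).contDiffAt hn).differentiableAt (by simp)).hasFDerivAt
  have hr : ContDiffOn ℝ ∞ (fun y ↦ w y ⬝ᵥ (R y : Fin m → ℝ)) V := by
    simp only [dotProduct]
    exact ContDiffOn.sum fun i _ ↦ (hw i).mul
      ((EuclideanSpace.proj (𝕜 := ℝ) i).contDiff.comp_contDiffOn hR)
  have dr := ((hr.contDiffAt hn).differentiableAt (by simp)).hasFDerivAt
  have h1 := (dG.clm_apply dR).clm_apply dR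
  have h2 := dτ.mul dr
  -- Differentiate `⟨R,R⟩ = τ (w·R)`: derivatives of `R` drop out because `R` is radical at `y`, and
  -- the derivative of `w·R` because `τ y = 0`.
  have he : (fun y ↦ G y (R y) (R y)) =ᶠ[𝓝 y]
      metricDet G * fun y ↦ w y ⬝ᵥ (R y : Fin m → ℝ) := by
    filter_upwards [hn] with z hz using hRw z hz (R z)
  have h3 := DFunLike.congr_fun (h1.unique (h2.congr_of_eventuallyEq he)) x
  have h4 : G y (R y) = 0 := by
    ext v
    rw [hRw y hy, hτ]
    simp
  have h5 (v : Coord m) : G y v (R y) = 0 := by rw [hsymm y hy, h4]; simp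
  simpa [h4, h5, hτ, mul_comm] using h3

/-- The last two terms of the Christoffel symbol cancel. Together with `fderiv_form_radical`, this
makes `Γ(x,R;R)` a nonzero multiple of `dτ(x)`, so it detects transversality to the singular set. -/
theorem christoffel_radical {y R : Coord m}
    (hsymm' : ∀ a b c, fderiv ℝ G y a b c = fderiv ℝ G y a c b) (x : Coord m) :
    christoffel G y x R R = (1 / 2) * fderiv ℝ G y x R R := by
  rw [christoffel, hsymm' R R x]
  ring

end RadicalFrame

/-! ### The local perturbation that moves the limit. -/

section LocalModification

open Matrix

set_option maxSynthPendingDepth 3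

variable {m : ℕ} {G : CoordForm m}

theorem fderiv_fderiv_form_symm {y : Coord m} (hsymm : ∀ᶠ x in 𝓝 y, ∀ v w, G x v w = G x w v)
    (hG : ContDiffAt ℝ ∞ G y) (a b c d : Coord m) :
    fderiv ℝ (fderiv ℝ G) y a b c d = fderiv ℝ (fderiv ℝ G) y a b d c := by
  have hd : DifferentiableAt ℝ (fderiv ℝ G) y :=
    (hG.fderiv_right (m := ∞) (by simp)).differentiableAt (by simp)
  have h (c d : Coord m) := ((hd.hasFDerivAt.clm_apply (hasFDerivAt_const b y)).clm_apply
    (hasFDerivAt_const c y)).clm_apply (hasFDerivAt_const d y)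
  have h3 : (fun x ↦ fderiv ℝ G x b c d) =ᶠ[𝓝 y] fun x ↦ fderiv ℝ G x b d c := by
    have h4 : ∀ᶠ x in 𝓝 y, ContDiffAt ℝ 1 G x :=
      (hG.of_le (by exact_mod_cast le_top)).eventually (by simp)
    filter_upwards [hsymm.eventually_nhds, h4] with x hx hx'
    exact fderiv_form_symm hx (hx'.differentiableAt (by simp)) b c d
  have := DFunLike.congr_fun (((h c d).congr_of_eventuallyEq h3.symm).unique (h d c)) a
  simpa using this

theorem christoffel_combination_left (y a b c d : Coord m) (α β : ℝ) :
    christoffel G y (α • a + β • b) c d = α * christoffel G y a c d + β * christoffel G y b c d := by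
  simp only [christoffel, map_add, map_smul, _root_.add_apply, _root_.smul_apply, smul_eq_mul]
  ring

theorem areaForm_change {y : Coord m} (hsymm : ∀ v w, G y v w = G y w v) (a b z : Coord m)
    (α β x : ℝ) :
    areaForm G y (a + (x * β) • z) (b + (-(x * α)) • z) (a + (x * β) • z) (b + (-(x * α)) • z) =
      areaForm G y a b a b + 2 * x * areaForm G y a b z (α • a + β • b)
        + x ^ 2 * areaForm G y z (α • a + β • b) z (α • a + β • b) := by
  refine curvatureLike_change (areaForm G y) ?_ ?_ ?_ ?_ a b z α β x
  · intro a a' b c d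
    simp only [areaForm, map_add, _root_.add_apply]
    ring
  · intro t a b c d
    simp only [areaForm, map_smul, _root_.smul_apply, smul_eq_mul]
    ring
  · intro a b c d
    simp only [areaForm]
    ring
  · intro a b c d
    simp only [areaForm, hsymm c, hsymm d]
    ring

theorem riem_change {y : Coord m} (hsymm : ∀ᶠ x in 𝓝 y, ∀ v w, G x v w = G x w v)
    (hG : ContDiffAt ℝ ∞ G y) (a b z : Coord m) (α β x : ℝ) :
    riem G y (a + (x * β) • z) (b + (-(x * α)) • z) (a + (x * β) • z) (b + (-(x * α)) • z) =
      riem G y a b a b + 2 * x * riem G y a b z (α • a + β • b)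
        + x ^ 2 * riem G y z (α • a + β • b) z (α • a + β • b) :=
  curvatureLike_change (riem G y) riem_add_left riem_smul_left
    (riem_swap_left hsymm.self_of_nhds)
    (riem_pair_symm hsymm.self_of_nhds
      (fderiv_form_symm hsymm (hG.differentiableAt (by simp)))
      (fderiv_fderiv_form_symm hsymm hG) (hG.isSymmSndFDerivAt (by simp only [minSmoothness_of_isRCLikeNormedField]; exact WithTop.coe_le_coe.2 le_top))) a b z α β x

/-- The pole of the curvature tensor along the singular set. -/
theorem polarPart_eq {y R : Coord m} {κ : ℝ}
    (hκ : ∀ ξ η : Fin m → ℝ, cometric G y ξ η = κ * (ξ ⬝ᵥ (R : Fin m → ℝ)) *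
      (η ⬝ᵥ (R : Fin m → ℝ))) (a b c d : Coord m) :
    polarPart G y a b c d = κ * (christoffel G y b d R * christoffel G y a c R
      - christoffel G y a d R * christoffel G y b c R) := by
  simp only [polarPart, hκ, dotProduct_christoffelVec]
  ring

/-- If the sectional curvature of `a ∧ b` extends smoothly over the singular set, then `a` and `b`
can be changed in a neighbourhood of a singular point, without changing their values on the
singular set, so that the sectional curvature still extends but its value at that point changes. -/
theorem exists_local_modification {W : Set (Coord m)} (hW : IsOpen W) {y₀ : Coord m} (hy₀ : y₀ ∈ W)
    (hτ : metricDet G y₀ = 0) (hG : ContDiffOn ℝ ∞ G W)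
    (hsymm : ∀ y ∈ W, ∀ v w, G y v w = G y w v)
    (hd : ∀ y ∈ W, metricDet G y = 0 → fderiv ℝ (metricDet G) y ≠ 0)
    (htan : ∀ y ∈ W, metricDet G y = 0 → ∀ v, G y v = 0 → fderiv ℝ (metricDet G) y v = 0)
    {a b : Coord m → Coord m} (ha : ContDiffOn ℝ ∞ a W) (hb : ContDiffOn ℝ ∞ b W)
    {k : Coord m → ℝ} (hk : ContDiffOn ℝ ∞ k W)
    (hdeg : ∀ y ∈ W, metricDet G y = 0 → areaForm G y (a y) (b y) (a y) (b y) = 0)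
    (hrk : ∀ y ∈ W, metricDet G y = 0 → ¬ (G y (a y) (a y) = 0 ∧ G y (b y) (b y) = 0))
    (hrad : ∀ y ∈ W, metricDet G y = 0 → ∀ v, G y v = 0 →
      v ∈ Submodule.span ℝ {a y, b y})
    (hK : ∀ y ∈ W, metricDet G y ≠ 0 →
      riem G y (a y) (b y) (a y) (b y) = k y * areaForm G y (a y) (b y) (a y) (b y)) :
    ∃ (S O : Set (Coord m)) (u v : Coord m → Coord m) (k' : Coord m → ℝ),
      IsCompact S ∧ S ⊆ W ∧ y₀ ∈ S ∧ IsOpen O ∧ O ⊆ W ∧ (∀ y ∈ S, metricDet G y = 0 → y ∈ O) ∧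
      ContDiff ℝ ∞ u ∧ ContDiff ℝ ∞ v ∧ (∀ y ∉ S, u y = 0 ∧ v y = 0) ∧
      (∀ y, metricDet G y = 0 → u y = 0 ∧ v y = 0) ∧
      ContDiffOn ℝ ∞ k' O ∧ (∀ y ∈ O, y ∉ S → k' y = k y) ∧
      (∀ y ∈ O, metricDet G y ≠ 0 →
        areaForm G y (a y + u y) (b y + v y) (a y + u y) (b y + v y) ≠ 0 ∧
        riem G y (a y + u y) (b y + v y) (a y + u y) (b y + v y) =
          k' y * areaForm G y (a y + u y) (b y + v y) (a y + u y) (b y + v y)) ∧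
      k' y₀ ≠ k y₀ := by
  obtain ⟨W', hW', hW'o, hyW', α, β, hα, hβ, hR⟩ :=
    exists_radical_combination hW hy₀ hτ hG ha hb hsymm hrk hrad
  set R : Coord m → Coord m := fun y ↦ α y • a y + β y • b y with hRdef
  have hRW' : ContDiffOn ℝ ∞ R W' := (hα.smul (ha.mono hW')).add (hβ.smul (hb.mono hW'))
  obtain ⟨V, hV, hVo, hyV, hdiv⟩ := exists_smooth_division hW'o hyW'
    (contDiffOn_metricDet (hG.mono hW')) hτ (hd y₀ hy₀ hτ)
  have hVW : V ⊆ W := hV.trans hW'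
  have hGV := hG.mono hVW
  have haV := ha.mono hVW
  have hbV := hb.mono hVW
  have hRV := hRW'.mono hV
  have hτV : ContDiffOn ℝ ∞ (metricDet G) V := contDiffOn_metricDet hGV
  have hsV : ∀ y ∈ V, ∀ v w, G y v w = G y w v := fun y hy ↦ hsymm y (hVW hy)
  have hdV : ∀ y ∈ V, metricDet G y = 0 → fderiv ℝ (metricDet G) y ≠ 0 :=
    fun y hy ↦ hd y (hVW hy)
  have hev : ∀ y ∈ V, ∀ᶠ x in 𝓝 y, ∀ v w, G x v w = G x w v := fun y hy ↦ by
    filter_upwards [hVo.mem_nhds hy] with x hx using hsV x hx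
  have hGat : ∀ y ∈ V, ContDiffAt ℝ ∞ G y := fun y hy ↦ hGV.contDiffAt (hVo.mem_nhds hy)
  have hs' : ∀ y ∈ V, ∀ a b c, fderiv ℝ G y a b c = fderiv ℝ G y a c b := fun y hy ↦
    fderiv_form_symm (hev y hy) ((hGat y hy).differentiableAt (by simp))
  -- division of the covector `⟨R, ·⟩`
  have hw1 (i : Fin m) := hdiv (fun y ↦ G y (R y) (unitVec i))
    (contDiffOn_form_apply (hG.mono hW') hRW' contDiffOn_const)
    (fun y hy h ↦ by rw [(hR y hy h).1]; rfl)
  choose w' hw hw' using hw1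
  set w : Coord m → Fin m → ℝ := fun y i ↦ w' i y
  have hRw : ∀ y ∈ V, ∀ v, G y (R y) v = metricDet G y * (w y ⬝ᵥ (v : Fin m → ℝ)) := by
    intro y hy v
    conv_lhs => rw [← sum_smul_unitVec v]
    simp only [map_sum, map_smul, smul_eq_mul, hw' _ y hy, dotProduct, Finset.mul_sum]
    exact Finset.sum_congr rfl fun i _ ↦ by simp only [w]; ring
  have hnorm := fun y (hy : y ∈ V) (h : metricDet G y = 0) ↦
    cometric_eq_of_division hVo hGV hsV hdV hRV hw hRw (fun y hy h ↦ (hR y (hV hy) h).2) hy h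
  have hfd := fun y (hy : y ∈ V) (h : metricDet G y = 0) ↦
    fderiv_form_radical hVo hGV hsV hRV hw hRw hy h
  -- This is where tangency of the radical enters, in the form `dτ(R) = 0`.
  have hIIRR : ∀ y ∈ V, metricDet G y = 0 → christoffel G y (R y) (R y) (R y) = 0 := by
    intro y hy h
    rw [christoffel_radical (hs' y hy), hfd y hy h,
      htan y (hVW hy) h _ (hR y (hV hy) h).1]
    simp
  -- division of the area of `a ∧ b`
  obtain ⟨δ, hδ, hδ'⟩ := hdiv _ (contDiffOn_areaForm (hG.mono hW') (ha.mono hW') (hb.mono hW')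
    (ha.mono hW') (hb.mono hW')) (fun y hy h ↦ hdeg y (hW' hy) h)
  have hr : ContDiffOn ℝ ∞ (fun y ↦ w y ⬝ᵥ (R y : Fin m → ℝ)) V := by
    simp only [dotProduct]
    exact ContDiffOn.sum fun i _ ↦ (hw i).mul
      ((EuclideanSpace.proj (𝕜 := ℝ) i).contDiff.comp_contDiffOn hRV)
  have hwc (c : Coord m → Coord m) (hc : ContDiffOn ℝ ∞ c V) :
      ContDiffOn ℝ ∞ (fun y ↦ w y ⬝ᵥ (c y : Fin m → ℝ)) V := by
    simp only [dotProduct]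
    exact ContDiffOn.sum fun i _ ↦ (hw i).mul
      ((EuclideanSpace.proj (𝕜 := ℝ) i).contDiff.comp_contDiffOn hc)
  -- Since `R ∧ b = α a ∧ b` and `R ∧ a = -β a ∧ b`, comparing Gram determinants and cancelling `τ`
  -- shows that on the singular set `α²δ = (w·R)⟨b,b⟩` and `β²δ = (w·R)⟨a,a⟩`. As `w·R ≠ 0`, `δ = 0`
  -- would make `⟨a,a⟩` and `⟨b,b⟩` both vanish.
  have hδ0 : ∀ y ∈ V, metricDet G y = 0 → δ y ≠ 0 := by
    intro y hy h h0
    have hα2 : ∀ y ∈ V, α y ^ 2 * δ y = (w y ⬝ᵥ (R y : Fin m → ℝ)) * G y (b y) (b y)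
        - metricDet G y * (w y ⬝ᵥ (b y : Fin m → ℝ)) ^ 2 := by
      refine eq_of_mul_eq_mul_of_regular hVo (((hα.mono hV).pow 2).mul hδ).continuousOn
        ((hr.mul (contDiffOn_form_apply hGV hbV hbV)).sub
          (hτV.mul ((hwc b hbV).pow 2))).continuousOn hdV fun z hz ↦ ?_
      have h1 := hRw z hz (R z)
      have h2 := hRw z hz (b z)
      have h3 := hδ' z hz
      have h4 : G z (R z) (R z) * G z (b z) (b z) - G z (R z) (b z) ^ 2 =
          α z ^ 2 * areaForm G z (a z) (b z) (a z) (b z) := by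
        simp only [hRdef, areaForm, map_add, map_smul, _root_.add_apply, _root_.smul_apply,
          smul_eq_mul, hsV z hz (b z) (a z)]
        ring
      rw [h1, h2, h3] at h4
      linarith
    have hβ2 : ∀ y ∈ V, β y ^ 2 * δ y = (w y ⬝ᵥ (R y : Fin m → ℝ)) * G y (a y) (a y)
        - metricDet G y * (w y ⬝ᵥ (a y : Fin m → ℝ)) ^ 2 := by
      refine eq_of_mul_eq_mul_of_regular hVo (((hβ.mono hV).pow 2).mul hδ).continuousOn
        ((hr.mul (contDiffOn_form_apply hGV haV haV)).sub
          (hτV.mul ((hwc a haV).pow 2))).continuousOn hdV fun z hz ↦ ?_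
      have h1 := hRw z hz (R z)
      have h2 := hRw z hz (a z)
      have h3 := hδ' z hz
      have h4 : G z (R z) (R z) * G z (a z) (a z) - G z (R z) (a z) ^ 2 =
          β z ^ 2 * areaForm G z (a z) (b z) (a z) (b z) := by
        simp only [hRdef, areaForm, map_add, map_smul, _root_.add_apply, _root_.smul_apply,
          smul_eq_mul, hsV z hz (b z) (a z)]
        ring
      rw [h1, h2, h3] at h4
      linarith
    obtain ⟨κ, hκ, -⟩ := hnorm y hy h
    have hr0 : w y ⬝ᵥ (R y : Fin m → ℝ) ≠ 0 := right_ne_zero_of_mul_eq_one hκ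
    have h1 := hα2 y hy
    have h2 := hβ2 y hy
    simp only [h0, h, mul_zero, zero_mul, sub_zero, zero_eq_mul, hr0, false_or] at h1 h2
    exact hrk y (hVW hy) h ⟨h2, h1⟩
  -- the pole of the curvature of `a ∧ b` vanishes
  have hpole : ∀ y ∈ V, metricDet G y = 0 →
      polarPart G y (a y) (b y) (a y) (b y) = 0 := by
    intro y hy h
    -- Off the singular set the curvature equation times `τ` reads `polarPart = τ (k τ δ -
    -- hessianPart)`. Both sides are continuous, so it persists where `τ = 0`.
    have h1 := eq_zero_of_forall_ne_zero (τ := metricDet G)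
      (k := fun y ↦ polarPart G y (a y) (b y) (a y) (b y) - metricDet G y *
        (k y * (metricDet G y * δ y) - hessianPart G y (a y) (b y) (a y) (b y))) hVo
      ((contDiffOn_polarPart hVo hGV haV hbV haV hbV).sub (hτV.mul
        (((hk.mono hVW).mul (hτV.mul hδ)).sub
          (contDiffOn_hessianPart hVo hGV haV hbV haV hbV)))).continuousOn ?_ hy (hdV y hy h)
    · simpa [h] using h1
    · intro z hz hz0
      have h2 := hK z (hVW hz) hz0
      rw [hδ' z hz, riem] at h2
      rw [← h2]
      field_simp
      ring
  -- The form `Γ(·,·;R)` on the plane of `a, b` has zero determinant, so rank at most one, and an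
  -- isotropic vector of such a form lies in its kernel. Here that vector is `R = αa + βb`.
  have hII : ∀ y ∈ V, metricDet G y = 0 →
      christoffel G y (a y) (R y) (R y) = 0 ∧ christoffel G y (b y) (R y) (R y) = 0 := by
    intro y hy h
    obtain ⟨κ, hκ1, hκ⟩ := hnorm y hy h
    have hκ0 : κ ≠ 0 := left_ne_zero_of_mul_eq_one hκ1
    have h1 := hpole y hy h
    rw [polarPart_eq hκ, mul_eq_zero, or_iff_right hκ0, christoffel_comm (hs' y hy) (b y) (a y)]
      at h1
    have h2 (x : Coord m) : christoffel G y x (R y) (R y) = α y * christoffel G y x (a y) (R y) +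
        β y * christoffel G y x (b y) (R y) := by
      rw [christoffel_comm (hs' y hy) x (R y)]
      conv_lhs => enter [3]; rw [hRdef]
      simp only
      rw [christoffel_combination_left, christoffel_comm (hs' y hy) x (a y),
        christoffel_comm (hs' y hy) x (b y)]
    have h3 : α y * christoffel G y (a y) (R y) (R y) +
        β y * christoffel G y (b y) (R y) (R y) = 0 := by
      rw [← christoffel_combination_left]
      exact hIIRR y hy h
    have h4 := h2 (a y)
    have h5 := h2 (b y)
    rw [christoffel_comm (hs' y hy) (b y) (a y)] at h5
    set A := christoffel G y (a y) (a y) (R y)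
    set B := christoffel G y (b y) (b y) (R y)
    set C := christoffel G y (a y) (b y) (R y)
    set X := christoffel G y (a y) (R y) (R y)
    set Y := christoffel G y (b y) (R y) (R y)
    constructor
    · have : X ^ 2 = 0 := by
        rw [h5, h4] at h3
        rw [h4]
        linear_combination A * h3 - β y ^ 2 * h1
      exact pow_eq_zero_iff two_ne_zero |>.1 this
    · have : Y ^ 2 = 0 := by
        rw [h5, h4] at h3
        rw [h5]
        linear_combination B * h3 - α y ^ 2 * h1
      exact pow_eq_zero_iff two_ne_zero |>.1 this
  -- the transverse vector and the divisions which depend on it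
  obtain ⟨z, hz⟩ : ∃ z, fderiv ℝ (metricDet G) y₀ z ≠ 0 := by
    by_contra! h
    exact hd y₀ hy₀ hτ (ContinuousLinearMap.ext h)
  set P : Coord m → ℝ := fun y ↦ polarPart G y z (R y) z (R y)
  have hzc : ContDiffOn ℝ ∞ (fun _ : Coord m ↦ z) V := contDiffOn_const
  -- With `Γ(R,R;R) = 0` only `-κ Γ(z,R;R)²` remains, and `Γ(z,R;R) = ½ (w·R) dτ(z) ≠ 0`.
  have hP0 : P y₀ ≠ 0 := by
    obtain ⟨κ, hκ1, hκ⟩ := hnorm y₀ hyV hτ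
    have hκ0 : κ ≠ 0 := left_ne_zero_of_mul_eq_one hκ1
    have hr0 : w y₀ ⬝ᵥ (R y₀ : Fin m → ℝ) ≠ 0 := right_ne_zero_of_mul_eq_one hκ1
    simp only [P]
    rw [polarPart_eq hκ, hIIRR y₀ hyV hτ, christoffel_comm (hs' y₀ hyV) (R y₀) z,
      christoffel_radical (hs' y₀ hyV), hfd y₀ hyV hτ, zero_mul, zero_sub]
    exact mul_ne_zero hκ0 (neg_ne_zero.2 (mul_self_ne_zero.2
      (mul_ne_zero (by norm_num) (mul_ne_zero hr0 hz))))
  have hRa : ∀ y ∈ W', metricDet G y = 0 → ∀ v, G y v (R y) = 0 := by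
    intro y hy h v
    rw [hsymm y (hW' hy), (hR y hy h).1]
    rfl
  obtain ⟨ε, hε, hε'⟩ := hdiv _ (contDiffOn_areaForm (hG.mono hW') (ha.mono hW') (hb.mono hW')
    (contDiffOn_const (c := z)) hRW') (fun y hy h ↦ by
      simp only [areaForm, hRa y hy h, mul_zero, zero_mul, sub_zero])
  have hT : ∀ y ∈ V, metricDet G y = 0 → polarPart G y (a y) (b y) z (R y) = 0 := by
    intro y hy h
    obtain ⟨κ, hκ1, hκ⟩ := hnorm y hy h
    rw [polarPart_eq hκ, (hII y hy h).1, (hII y hy h).2]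
    ring
  -- A second division is needed because the vanishing `hT` is known only on `V`, not on the larger
  -- set on which the first division was set up.
  obtain ⟨V₂, hV₂, hV₂o, hyV₂, hdiv₂⟩ := exists_smooth_division hVo hyV hτV hτ (hd y₀ hy₀ hτ)
  obtain ⟨t, ht, ht'⟩ := hdiv₂ _ (contDiffOn_polarPart hVo hGV haV hbV hzc hRV) hT
  obtain ⟨ρ, hρ, hball⟩ := Metric.isOpen_iff.1 hV₂o y₀ hyV₂
  let χ : ContDiffBump y₀ := ⟨ρ / 3, ρ / 2, by positivity, by linarith⟩
  have hχV₂ : Metric.closedBall y₀ χ.rOut ⊆ V₂ :=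
    (Metric.closedBall_subset_ball (by simp [χ]; linarith)).trans hball
  have hχV : Metric.closedBall y₀ χ.rOut ⊆ V := hχV₂.trans hV₂
  have hχ1 : χ y₀ = 1 := χ.one_of_mem_closedBall (Metric.mem_closedBall_self χ.rIn_pos.le)
  have hχ0 : ∀ y ∉ Metric.closedBall y₀ χ.rOut, χ y = 0 := fun y hy ↦ χ.zero_of_le_dist (by
    simp only [Metric.mem_closedBall, not_le] at hy
    exact hy.le)
  set F : Coord m → ℝ := fun y ↦ hessianPart G y (a y) (b y) z (R y) + t y
  -- If both `s = 1` and `s = -1` failed, adding the two equations would give `P y₀ = 0`.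
  obtain ⟨s, hs⟩ : ∃ s : ℝ, 2 * s * F y₀ + s ^ 2 * P y₀ ≠ 0 := by
    by_contra! h
    have h1 := h 1
    have h2 := h (-1)
    exact hP0 (by linarith)
  have hχs : ContDiff ℝ ∞ χ := χ.contDiff
  -- The Gram determinant of the changed pair divided by `τ`, from `areaForm_change` with `x = sχτ`;
  -- it agrees with `δ` where `τ = 0`.
  set δ' : Coord m → ℝ := fun y ↦ δ y + 2 * s * χ y * metricDet G y * ε y +
    s ^ 2 * χ y ^ 2 * metricDet G y * areaForm G y z (R y) z (R y) with hδ'def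
  have hδ's : ContDiffOn ℝ ∞ δ' V := by
    refine (hδ.add ((((contDiffOn_const.mul hχs.contDiffOn).mul hτV)).mul hε)).add
      (((contDiffOn_const.mul (hχs.contDiffOn.pow 2)).mul hτV).mul ?_)
    exact contDiffOn_areaForm hGV hzc hRV hzc hRV
  -- The numerator is the changed curvature divided by `τ`: one factor `τ` of `x²` absorbs the pole
  -- of `riem z R z R`, and `t` replaces the pole of the cross term.
  set k' : Coord m → ℝ := fun y ↦ (k y * δ y + 2 * s * χ y * F y + s ^ 2 * χ y ^ 2 *
    (metricDet G y * hessianPart G y z (R y) z (R y) + P y)) / δ' y with hk'def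
  -- The perturbations are `xβ z` and `-xα z` with `x = sχτ`: the factor `τ` preserves the values on
  -- the singular set, and `χ` confines the change to a compact ball.
  refine ⟨Metric.closedBall y₀ χ.rOut, V₂ ∩ δ' ⁻¹' {0}ᶜ,
    fun y ↦ χ y • ((s * metricDet G y * β y) • z),
    fun y ↦ χ y • ((-(s * metricDet G y * α y)) • z), k', isCompact_closedBall _ _,
    hχV.trans hVW, Metric.mem_closedBall_self χ.rOut_pos.le,
    (hδ's.mono hV₂).continuousOn.isOpen_inter_preimage hV₂o isOpen_compl_singleton,
    Set.inter_subset_left.trans (hV₂.trans hVW), ?_, ?_, ?_, ?_, ?_, ?_, ?_, ?_, ?_⟩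
  · intro y hy h
    refine ⟨hχV₂ hy, ?_⟩
    simp only [Set.mem_preimage, Set.mem_compl_iff, Set.mem_singleton_iff, hδ'def, h, mul_zero,
      zero_mul, add_zero]
    exact hδ0 y (hχV hy) h
  · exact contDiff_bump_smul χ hVo hχV
      (((contDiffOn_const.mul hτV).mul (hβ.mono hV)).smul contDiffOn_const)
  · exact contDiff_bump_smul χ hVo hχV
      (((contDiffOn_const.mul hτV).mul (hα.mono hV)).neg.smul contDiffOn_const)
  · intro y hy
    simp [hχ0 y hy]
  · intro y hy
    simp [hy]
  · have hsub : V₂ ∩ δ' ⁻¹' {0}ᶜ ⊆ V := Set.inter_subset_left.trans hV₂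
    have hH1 := contDiffOn_hessianPart hVo hGV haV hbV hzc hRV
    have hH2 := contDiffOn_hessianPart hVo hGV hzc hRV hzc hRV
    have hPs : ContDiffOn ℝ ∞ P V := contDiffOn_polarPart hVo hGV hzc hRV hzc hRV
    refine ContDiffOn.div ?_ (hδ's.mono hsub) (fun y hy ↦ hy.2)
    refine ((((hk.mono hVW).mono hsub).mul (hδ.mono hsub)).add
      ((contDiffOn_const.mul hχs.contDiffOn).mul
        ((hH1.mono hsub).add (ht.mono Set.inter_subset_left)))).add
      ((contDiffOn_const.mul (hχs.contDiffOn.pow 2)).mul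
        (((hτV.mul hH2).add hPs).mono hsub))
  · rintro y ⟨hyV₂, hy0⟩ hyS
    have h1 : δ' y = δ y := by simp [hδ'def, hχ0 y hyS]
    have h2 : δ y ≠ 0 := by rw [← h1]; exact hy0
    simp only [hk'def, h1, hχ0 y hyS]
    field_simp
    ring
  · rintro y ⟨hyV₂, hy0⟩ hτy
    have hyV := hV₂ hyV₂
    have hu : χ y • ((s * metricDet G y * β y) • z) = ((s * χ y * metricDet G y) * β y) • z := by
      rw [smul_smul]
      congr 1
      ring
    have hv : χ y • ((-(s * metricDet G y * α y)) • z) =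
        (-((s * χ y * metricDet G y) * α y)) • z := by
      rw [smul_smul]
      congr 1
      ring
    have hA : areaForm G y (a y + χ y • ((s * metricDet G y * β y) • z))
        (b y + χ y • ((-(s * metricDet G y * α y)) • z))
        (a y + χ y • ((s * metricDet G y * β y) • z))
        (b y + χ y • ((-(s * metricDet G y * α y)) • z)) = metricDet G y * δ' y := by
      rw [hu, hv, areaForm_change (hsV y hyV), hδ' y hyV]
      have h1 := hε' y hyV
      simp only [hRdef] at h1
      rw [h1]
      simp only [hδ'def]
      ring
    refine ⟨?_, ?_⟩
    · rw [hA]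
      exact mul_ne_zero hτy hy0
    · beta_reduce
      rw [hA, hu, hv, riem_change (hev y hyV) (hGat y hyV), hK y (hVW hyV) hτy, hδ' y hyV]
      change _ + 2 * _ * riem G y (a y) (b y) z (R y) + _ * riem G y z (R y) z (R y) = _
      have h1 := ht' y hyV₂
      simp only [riem, h1]
      have h2 : k' y * (metricDet G y * δ' y) = metricDet G y * (k y * δ y + 2 * s * χ y * F y +
          s ^ 2 * χ y ^ 2 * (metricDet G y * hessianPart G y z (R y) z (R y) + P y)) := by
        simp only [hk'def]
        have : δ' y ≠ 0 := hy0
        field_simp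
      rw [h2]
      simp only [F, P]
      field_simp
  · have h1 : δ' y₀ = δ y₀ := by simp [hδ'def, hτ]
    have h2 := hδ0 y₀ hyV hτ
    simp only [hk'def, h1, hχ1, hτ]
    intro h3
    rw [div_eq_iff h2] at h3
    exact hs (by linarith)

end LocalModification

/-! ### Vector fields and forms transported to charts. -/

section Charts

set_option maxSynthPendingDepth 3

variable {m : ℕ} {M : Type*} [TopologicalSpace M] [ChartedSpace (EuclideanSpace ℝ (Fin m)) M]

/-- The differential of the inverse of a chart. -/
def coordFrame (e : OpenPartialHomeomorph M (Coord m)) (y : Coord m) :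
    Coord m →L[ℝ] TangentSpace (𝓡 m) (e.symm y) :=
  mfderiv (𝓡 m) (𝓡 m) e.symm y

/-- The coordinate expression of a vector field. -/
def coordField (e : OpenPartialHomeomorph M (Coord m)) (V : VField m M) : Coord m → Coord m :=
  fun y ↦ VectorField.mpullback (𝓡 m) (𝓡 m) e.symm V y

/-- The coordinate expression of a field of bilinear forms. -/
def coordForm (e : OpenPartialHomeomorph M (Coord m)) (g : FormField m M) : CoordForm m :=
  fun y ↦ ContinuousLinearMap.bilinearComp (E := Coord m) (F := Coord m)
    (g (e.symm y)) (coordFrame e y) (coordFrame e y)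

/-- The vector field on the source of a chart with given coordinate expression. -/
def liftField (e : OpenPartialHomeomorph M (Coord m)) (v : Coord m → Coord m) : VField m M :=
  VectorField.mpullback (𝓡 m) (𝓡 m) e (fun y ↦ (v y : TangentSpace (𝓡 m) y))

theorem coordForm_apply (e : OpenPartialHomeomorph M (Coord m)) (g : FormField m M)
    (y v w : Coord m) : coordForm e g y v w = g (e.symm y) (coordFrame e y v) (coordFrame e y w) :=
  rfl

variable {e : OpenPartialHomeomorph M (Coord m)}

theorem contMDiffAt_chart_symm (he : e ∈ IsManifold.maximalAtlas (𝓡 m) ∞ M) {y : Coord m}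
    (hy : y ∈ e.target) : ContMDiffAt (𝓡 m) (𝓡 m) ∞ e.symm y :=
  contMDiffAt_symm_of_mem_maximalAtlas he hy

theorem mdifferentiable_of_mem_maximalAtlas (he : e ∈ IsManifold.maximalAtlas (𝓡 m) ∞ M) :
    e.MDifferentiable (𝓡 m) (𝓡 m) :=
  ⟨(contMDiffOn_of_mem_maximalAtlas he).mdifferentiableOn (by simp),
    (contMDiffOn_symm_of_mem_maximalAtlas he).mdifferentiableOn (by simp)⟩

theorem isInvertible_mfderiv_chart (he : e ∈ IsManifold.maximalAtlas (𝓡 m) ∞ M) {p : M}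
    (hp : p ∈ e.source) : (mfderiv (𝓡 m) (𝓡 m) e p).IsInvertible :=
  ⟨(mdifferentiable_of_mem_maximalAtlas he).mfderiv hp, rfl⟩

theorem isInvertible_mfderiv_chart_symm (he : e ∈ IsManifold.maximalAtlas (𝓡 m) ∞ M)
    {y : Coord m} (hy : y ∈ e.target) : (mfderiv (𝓡 m) (𝓡 m) e.symm y).IsInvertible :=
  ⟨(mdifferentiable_of_mem_maximalAtlas he).symm.mfderiv hy, rfl⟩

theorem coordFrame_coordField (he : e ∈ IsManifold.maximalAtlas (𝓡 m) ∞ M) {y : Coord m}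
    (hy : y ∈ e.target) (V : VField m M) : coordFrame e y (coordField e V y) = V (e.symm y) :=
  (isInvertible_mfderiv_chart_symm he hy).self_apply_inverse _

theorem coordFrame_injective (he : e ∈ IsManifold.maximalAtlas (𝓡 m) ∞ M) {y : Coord m}
    (hy : y ∈ e.target) : Function.Injective (coordFrame e y) :=
  (isInvertible_mfderiv_chart_symm he hy).injective

theorem coordFrame_surjective (he : e ∈ IsManifold.maximalAtlas (𝓡 m) ∞ M) {y : Coord m}
    (hy : y ∈ e.target) : Function.Surjective (coordFrame e y) :=
  (isInvertible_mfderiv_chart_symm he hy).surjective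

theorem coordForm_coordField (he : e ∈ IsManifold.maximalAtlas (𝓡 m) ∞ M) (g : FormField m M)
    {y : Coord m} (hy : y ∈ e.target) (V W : VField m M) :
    coordForm e g y (coordField e V y) (coordField e W y) =
      g (e.symm y) (V (e.symm y)) (W (e.symm y)) := by
  rw [coordForm_apply, coordFrame_coordField he hy, coordFrame_coordField he hy]

theorem coordField_liftField (he : e ∈ IsManifold.maximalAtlas (𝓡 m) ∞ M) {y : Coord m}
    (hy : y ∈ e.target) (v : Coord m → Coord m) : coordField e (liftField e v) y = v y := by
  have h1 := isInvertible_mfderiv_chart he (e.map_target hy)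
  refine ((isInvertible_mfderiv_chart_symm he hy).inverse_apply_eq).2 ?_
  refine (h1.inverse_apply_eq).2 ?_
  have h2 := DFunLike.congr_fun ((mdifferentiable_of_mem_maximalAtlas he).comp_symm_deriv hy) (v y)
  refine Eq.trans ?_ h2.symm
  change v (e (e.symm y)) = v y
  rw [e.right_inv hy]

theorem liftField_eq_coordFrame (he : e ∈ IsManifold.maximalAtlas (𝓡 m) ∞ M) {y : Coord m}
    (hy : y ∈ e.target) (v : Coord m → Coord m) :
    liftField e v (e.symm y) = coordFrame e y (v y) := by
  rw [← coordFrame_coordField he hy (liftField e v), coordField_liftField he hy]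

theorem liftField_coordField (he : e ∈ IsManifold.maximalAtlas (𝓡 m) ∞ M) {p : M}
    (hp : p ∈ e.source) (V : VField m M) : liftField e (coordField e V) p = V p := by
  obtain ⟨y, hy, rfl⟩ : ∃ y ∈ e.target, e.symm y = p := ⟨e p, e.map_source hp, e.left_inv hp⟩
  rw [liftField_eq_coordFrame he hy, coordFrame_coordField he hy]

theorem dirDeriv_eq (he : e ∈ IsManifold.maximalAtlas (𝓡 m) ∞ M) {y : Coord m}
    (hy : y ∈ e.target) (A : VField m M) {f : M → ℝ}
    (hf : MDifferentiableAt (𝓡 m) 𝓘(ℝ, ℝ) f (e.symm y)) :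
    dirDeriv A f (e.symm y) = fderiv ℝ (f ∘ e.symm) y (coordField e A y) := by
  have h1 := mfderiv_comp y hf ((mdifferentiable_of_mem_maximalAtlas he).mdifferentiableAt_symm hy)
  rw [mfderiv_eq_fderiv] at h1
  rw [dirDeriv, ← coordFrame_coordField he hy A]
  exact (DFunLike.congr_fun h1 (coordField e A y)).symm

variable [IsManifold (𝓡 m) ∞ M]

theorem contDiffAt_coordField (he : e ∈ IsManifold.maximalAtlas (𝓡 m) ∞ M) {y : Coord m}
    (hy : y ∈ e.target) {V : VField m M}
    (hV : ContMDiffAt (𝓡 m) (𝓡 m).tangent ∞ (fun p ↦ (⟨p, V p⟩ : TangentBundle (𝓡 m) M))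
      (e.symm y)) : ContDiffAt ℝ ∞ (coordField e V) y := by
  have : IsManifold (𝓡 m) 1 M := .of_le (n := ∞) (by exact_mod_cast le_top)
  refine contMDiffAt_vectorSpace_iff_contDiffAt.1 ?_
  exact hV.mpullback_vectorField_preimage (contMDiffAt_chart_symm he hy)
    (isInvertible_mfderiv_chart_symm he hy) (by simp)

theorem differentiableAt_coordField (he : e ∈ IsManifold.maximalAtlas (𝓡 m) ∞ M) {y : Coord m}
    (hy : y ∈ e.target) {V : VField m M}
    (hV : MDifferentiableAt (𝓡 m) (𝓡 m).tangent (fun p ↦ (⟨p, V p⟩ : TangentBundle (𝓡 m) M))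
      (e.symm y)) : DifferentiableAt ℝ (coordField e V) y := by
  have : IsManifold (𝓡 m) 1 M := .of_le (n := ∞) (by exact_mod_cast le_top)
  have h1 := hV.mpullback_vectorField (contMDiffAt_chart_symm he hy)
    (isInvertible_mfderiv_chart_symm he hy) (WithTop.coe_le_coe.2 le_top)
  have h2 := ((contMDiff_snd_tangentBundle_modelSpace (n := 1) (Coord m) (𝓡 m)).mdifferentiable
    one_ne_zero).mdifferentiableAt.comp y h1
  exact mdifferentiableAt_iff_differentiableAt.1 h2

theorem contMDiffAt_liftField (he : e ∈ IsManifold.maximalAtlas (𝓡 m) ∞ M) {p : M}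
    (hp : p ∈ e.source) {v : Coord m → Coord m} (hv : ContDiffAt ℝ ∞ v (e p)) :
    ContMDiffAt (𝓡 m) (𝓡 m).tangent ∞
      (fun p ↦ (⟨p, liftField e v p⟩ : TangentBundle (𝓡 m) M)) p := by
  have : IsManifold (𝓡 m) 1 M := .of_le (n := ∞) (by exact_mod_cast le_top)
  refine ContMDiffAt.mpullback_vectorField_preimage (n := ∞) ?_
    (contMDiffAt_of_mem_maximalAtlas he hp) (isInvertible_mfderiv_chart he hp) (by simp)
  exact contMDiffAt_vectorSpace_iff_contDiffAt.2 hv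

/-- `leviCivita` is defined pointwise by choice, so differentiability of `∇_B C` is known only
through its coordinate expression; this brings it back to `M`, so that the connection can be applied
a second time. -/
theorem mdifferentiableAt_of_coordField (he : e ∈ IsManifold.maximalAtlas (𝓡 m) ∞ M) {y : Coord m}
    (hy : y ∈ e.target) {V : VField m M} (hV : DifferentiableAt ℝ (coordField e V) y) :
    MDifferentiableAt (𝓡 m) (𝓡 m).tangent (fun p ↦ (⟨p, V p⟩ : TangentBundle (𝓡 m) M))
      (e.symm y) := by
  have : IsManifold (𝓡 m) 1 M := .of_le (n := ∞) (by exact_mod_cast le_top)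
  have hp := e.map_target hy
  have h1 : MDifferentiableAt (𝓡 m) (𝓡 m).tangent
      (fun x ↦ (⟨x, coordField e V x⟩ : TangentBundle (𝓡 m) (Coord m))) (e (e.symm y)) := by
    rw [e.right_inv hy, mdifferentiableAt_totalSpace]
    refine ⟨mdifferentiableAt_id, ?_⟩
    convert! hV.mdifferentiableAt with x
    simp
  have h2 := h1.mpullback_vectorField (contMDiffAt_of_mem_maximalAtlas he hp)
    (isInvertible_mfderiv_chart he hp) (WithTop.coe_le_coe.2 le_top)
  refine h2.congr_of_eventuallyEq ?_
  filter_upwards [e.open_source.mem_nhds hp] with q hq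
  exact congrArg (fun v ↦ (⟨q, v⟩ : TangentBundle (𝓡 m) M)) (liftField_coordField he hq V).symm

theorem coordField_mlieBracket (he : e ∈ IsManifold.maximalAtlas (𝓡 m) ∞ M) {y : Coord m}
    (hy : y ∈ e.target) {V W : VField m M}
    (hV : MDifferentiableAt (𝓡 m) (𝓡 m).tangent (fun p ↦ (⟨p, V p⟩ : TangentBundle (𝓡 m) M))
      (e.symm y))
    (hW : MDifferentiableAt (𝓡 m) (𝓡 m).tangent (fun p ↦ (⟨p, W p⟩ : TangentBundle (𝓡 m) M))
      (e.symm y)) :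
    coordField e (VectorField.mlieBracket (𝓡 m) V W) y =
      fderiv ℝ (coordField e W) y (coordField e V y)
        - fderiv ℝ (coordField e V) y (coordField e W y) := by
  have : IsManifold (𝓡 m) (minSmoothness ℝ 3) M := .of_le (n := ∞) (by
    simp only [minSmoothness_of_isRCLikeNormedField]; exact WithTop.coe_le_coe.2 le_top)
  have h := VectorField.mpullback_mlieBracket (I := 𝓡 m) (I' := 𝓡 m) (n := ∞) hV hW
    (contMDiffAt_chart_symm he hy)
    (by simp only [minSmoothness_of_isRCLikeNormedField]; exact WithTop.coe_le_coe.2 le_top)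
  refine h.trans ?_
  rw [← VectorField.mlieBracketWithin_univ, VectorField.mlieBracketWithin_eq_lieBracketWithin]
  exact congrFun (VectorField.lieBracketWithin_univ (𝕜 := ℝ) (V := coordField e V)
    (W := coordField e W)) y

theorem contMDiffAt_form_apply {g : FormField m M} (hg : SmoothFormField g)
    {p : M} {V W : VField m M}
    (hV : ContMDiffAt (𝓡 m) (𝓡 m).tangent ∞ (fun p ↦ (⟨p, V p⟩ : TangentBundle (𝓡 m) M)) p)
    (hW : ContMDiffAt (𝓡 m) (𝓡 m).tangent ∞ (fun p ↦ (⟨p, W p⟩ : TangentBundle (𝓡 m) M)) p) :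
    ContMDiffAt (𝓡 m) 𝓘(ℝ, ℝ) ∞ (fun q ↦ g q (V q) (W q)) p := by
  have : IsManifold (𝓡 m) 1 M := .of_le (n := ∞) (by exact_mod_cast le_top)
  have : ContMDiffAt (𝓡 m) ((𝓡 m).prod 𝓘(ℝ)) ∞
      (fun q ↦ Bundle.TotalSpace.mk' ℝ (E := Bundle.Trivial M ℝ) q (g q (V q) (W q))) p := by
    apply ContMDiffAt.clm_bundle_apply₂ (F₁ := Coord m) (F₂ := Coord m)
    · exact hg.contMDiffAt
    · exact hV
    · exact hW
  simp only [Bundle.contMDiffAt_totalSpace] at this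
  exact this.2

theorem mdifferentiableAt_form_apply {g : FormField m M}
    (hg : SmoothFormField g) {p : M} {V W : VField m M}
    (hV : MDifferentiableAt (𝓡 m) (𝓡 m).tangent (fun p ↦ (⟨p, V p⟩ : TangentBundle (𝓡 m) M)) p)
    (hW : MDifferentiableAt (𝓡 m) (𝓡 m).tangent (fun p ↦ (⟨p, W p⟩ : TangentBundle (𝓡 m) M)) p) :
    MDifferentiableAt (𝓡 m) 𝓘(ℝ, ℝ) (fun q ↦ g q (V q) (W q)) p := by
  have : IsManifold (𝓡 m) 1 M := .of_le (n := ∞) (by exact_mod_cast le_top)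
  have : MDifferentiableAt (𝓡 m) ((𝓡 m).prod 𝓘(ℝ))
      (fun q ↦ Bundle.TotalSpace.mk' ℝ (E := Bundle.Trivial M ℝ) q (g q (V q) (W q))) p := by
    apply MDifferentiableAt.clm_bundle_apply₂ (F₁ := Coord m) (F₂ := Coord m)
    · exact hg.contMDiffAt.mdifferentiableAt (by simp)
    · exact hV
    · exact hW
  simp only [mdifferentiableAt_totalSpace] at this
  exact this.2

theorem contDiffOn_coordForm (he : e ∈ IsManifold.maximalAtlas (𝓡 m) ∞ M) {g : FormField m M}
    (hg : SmoothFormField g) : ContDiffOn ℝ ∞ (coordForm e g) e.target := by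
  have : IsManifold (𝓡 m) 1 M := .of_le (n := ∞) (by exact_mod_cast le_top)
  refine contDiffOn_clm_apply.2 fun v ↦ contDiffOn_clm_apply.2 fun w ↦ ?_
  have h : ContDiffOn ℝ ∞ ((fun q ↦ g q (liftField e (fun _ ↦ v) q) (liftField e (fun _ ↦ w) q)) ∘
      e.symm) e.target := by
    refine contMDiffOn_iff_contDiffOn.1 fun y hy ↦ ?_
    refine ContMDiffAt.contMDiffWithinAt ?_
    refine ContMDiffAt.comp y ?_ (contMDiffAt_chart_symm he hy)
    exact contMDiffAt_form_apply hg (contMDiffAt_liftField he (e.map_target hy) contDiffAt_const)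
      (contMDiffAt_liftField he (e.map_target hy) contDiffAt_const)
  refine h.congr fun y hy ↦ ?_
  rw [coordForm_apply, Function.comp_apply, liftField_eq_coordFrame he hy,
    liftField_eq_coordFrame he hy]

end Charts

/-! ### The Levi-Civita connection and its curvature in coordinates. -/

section CurvatureInCharts

open Matrix

set_option maxSynthPendingDepth 3

variable {m : ℕ}

/-- The vector `g⁻¹ Γ(a, b)`. -/
def christoffelRaised (G : CoordForm m) (y a b : Coord m) : Coord m :=
  WithLp.toLp 2 ((metricDet G y)⁻¹ • (gramMatrix G y).adjugate *ᵥ christoffelVec G y a b)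

theorem form_christoffelRaised {G : CoordForm m} {y : Coord m}
    (hsymm : ∀ v w, G y v w = G y w v) (hτ : metricDet G y ≠ 0) (a b c : Coord m) :
    G y (christoffelRaised G y a b) c = christoffel G y a b c := by
  rw [hsymm, form_eq_dotProduct, christoffelRaised, WithLp.ofLp_toLp, mulVec_smul, mulVec_mulVec,
    mul_adjugate]
  change _ ⬝ᵥ (metricDet G y)⁻¹ • ((metricDet G y • (1 : Matrix (Fin m) (Fin m) ℝ)) *ᵥ _) = _
  rw [smul_mulVec, one_mulVec, smul_smul, inv_mul_cancel₀ hτ, one_smul, dotProduct_comm,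
    dotProduct_christoffelVec]

theorem christoffel_christoffelRaised {G : CoordForm m} {y : Coord m} (a b c d : Coord m) :
    christoffel G y a b (christoffelRaised G y c d) =
      (metricDet G y)⁻¹ * cometric G y (christoffelVec G y a b) (christoffelVec G y c d) := by
  rw [← dotProduct_christoffelVec, christoffelRaised, WithLp.ofLp_toLp, dotProduct_smul,
    smul_eq_mul, cometric]

theorem contDiffOn_christoffelRaised {G : CoordForm m} {W : Set (Coord m)} (hW : IsOpen W)
    (hG : ContDiffOn ℝ ∞ G W) (hτ : ∀ y ∈ W, metricDet G y ≠ 0) {a b : Coord m → Coord m}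
    (ha : ContDiffOn ℝ ∞ a W) (hb : ContDiffOn ℝ ∞ b W) :
    ContDiffOn ℝ ∞ (fun y ↦ christoffelRaised G y (a y) (b y)) W := by
  refine contDiffOn_piLp' 2 fun i ↦ ?_
  simp only [christoffelRaised, Pi.smul_apply, smul_eq_mul, mulVec, dotProduct]
  exact ((contDiffOn_metricDet hG).inv hτ).mul (ContDiffOn.sum fun j _ ↦
    (contDiffOn_adjugate hG i j).mul (contDiffOn_christoffel hW hG ha hb contDiffOn_const))

theorem form_nondegenerate {G : CoordForm m} {y : Coord m}
    (hsymm : ∀ v w, G y v w = G y w v) (hτ : metricDet G y ≠ 0) {v w : Coord m}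
    (h : ∀ c, G y v c = G y w c) : v = w := by
  by_contra hvw
  refine hτ ((metricDet_eq_zero_iff hsymm).2 ⟨v - w, sub_ne_zero.2 hvw, ?_⟩)
  ext c
  simp [h c]

/-- The coordinate expression of the covariant derivative `∇_X Y`. -/
def coordCov (G : CoordForm m) (X Y : Coord m → Coord m) (y : Coord m) : Coord m :=
  fderiv ℝ Y y (X y) + christoffelRaised G y (X y) (Y y)

theorem contDiffOn_coordCov {G : CoordForm m} {W : Set (Coord m)} (hW : IsOpen W)
    (hG : ContDiffOn ℝ ∞ G W) (hτ : ∀ y ∈ W, metricDet G y ≠ 0) {X Y : Coord m → Coord m}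
    (hX : ContDiffOn ℝ ∞ X W) (hY : ContDiffOn ℝ ∞ Y W) : ContDiffOn ℝ ∞ (coordCov G X Y) W :=
  ((hY.fderiv_of_isOpen hW (by simp)).clm_apply hX).add
    (contDiffOn_christoffelRaised hW hG hτ hX hY)

theorem form_coordCov {G : CoordForm m} {y : Coord m}
    (hsymm : ∀ v w, G y v w = G y w v) (hτ : metricDet G y ≠ 0) (X Y : Coord m → Coord m)
    (d : Coord m) : G y (coordCov G X Y y) d =
      G y (fderiv ℝ Y y (X y)) d + christoffel G y (X y) (Y y) d := by
  rw [coordCov, map_add, _root_.add_apply, form_christoffelRaised hsymm hτ]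

/-- Metric compatibility, `Γ(a,v;d) + Γ(a,d;v) = ∂_a g(v,d)`. It makes it possible to differentiate
`∇_B C` without differentiating the inverse metric. -/
theorem christoffel_eq_sub {G : CoordForm m} {y : Coord m}
    (hs : ∀ u v w, fderiv ℝ G y u v w = fderiv ℝ G y u w v) (a v d : Coord m) :
    christoffel G y a v d = fderiv ℝ G y a v d - christoffel G y a d v := by
  simp only [christoffel]
  rw [hs a d v, hs v d a, hs d v a]
  ring

/-- The second covariant derivative `∇_A ∇_B C` in coordinates. -/
theorem form_coordCov_coordCov {G : CoordForm m} {W : Set (Coord m)} (hW : IsOpen W)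
    (hG : ContDiffOn ℝ ∞ G W) (hsymm : ∀ y ∈ W, ∀ v w, G y v w = G y w v)
    (hτ : ∀ y ∈ W, metricDet G y ≠ 0) {A B C : Coord m → Coord m}
    (hB : ContDiffOn ℝ ∞ B W) (hC : ContDiffOn ℝ ∞ C W)
    {y : Coord m} (hy : y ∈ W) (d : Coord m) :
    G y (coordCov G A (coordCov G B C) y) d =
      christoffel G y (A y) (fderiv ℝ C y (B y)) d + christoffel G y (B y) (fderiv ℝ C y (A y)) d
      + G y (fderiv ℝ (fderiv ℝ C) y (A y) (B y)) d + G y (fderiv ℝ C y (fderiv ℝ B y (A y))) d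
      + christoffel G y (fderiv ℝ B y (A y)) (C y) d
      + (1 / 2) * (fderiv ℝ (fderiv ℝ G) y (A y) (B y) (C y) d
        + fderiv ℝ (fderiv ℝ G) y (A y) (C y) d (B y)
        - fderiv ℝ (fderiv ℝ G) y (A y) d (B y) (C y))
      - christoffel G y (A y) d (christoffelRaised G y (B y) (C y)) := by
  have hn := hW.mem_nhds hy
  have hGat : ContDiffAt ℝ ∞ G y := hG.contDiffAt hn
  have hev : ∀ᶠ x in 𝓝 y, ∀ v w, G x v w = G x w v := by
    filter_upwards [hn] with x hx using hsymm x hx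
  have hs' := fderiv_form_symm hev (hGat.differentiableAt (by simp))
  have hG' : ContDiffOn ℝ ∞ (fderiv ℝ G) W := hG.fderiv_of_isOpen hW (by simp)
  have dG := (hGat.differentiableAt (by simp)).hasFDerivAt
  have dG' := ((hG'.contDiffAt hn).differentiableAt (by simp)).hasFDerivAt
  have hC' : ContDiffOn ℝ ∞ (fderiv ℝ C) W := hC.fderiv_of_isOpen hW (by simp)
  have dC' := ((hC'.contDiffAt hn).differentiableAt (by simp)).hasFDerivAt
  have dC := ((hC.contDiffAt hn).differentiableAt (by simp)).hasFDerivAt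
  have dB := ((hB.contDiffAt hn).differentiableAt (by simp)).hasFDerivAt
  have dV := (((contDiffOn_coordCov hW hG hτ hB hC).contDiffAt hn).differentiableAt
    (by simp)).hasFDerivAt
  have dd := hasFDerivAt_const (𝕜 := ℝ) d y
  -- Lowered with `d`, the inner covariant derivative involves only `G`, its first derivative and
  -- the fields, so it can be differentiated directly; comparing with the product rule isolates the
  -- derivative of `coordCov G B C`.
  have he : (fun x ↦ G x (coordCov G B C x) d) =ᶠ[𝓝 y] fun x ↦ G x (fderiv ℝ C x (B x)) d +
      (1 / 2) * (fderiv ℝ G x (B x) (C x) d + fderiv ℝ G x (C x) d (B x)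
        - fderiv ℝ G x d (B x) (C x)) := by
    filter_upwards [hn] with x hx
    rw [form_coordCov (hsymm x hx) (hτ x hx)]
    rfl
  have h1 := (dG.clm_apply dV).clm_apply dd
  have h2 := ((dG.clm_apply (dC'.clm_apply dB)).clm_apply dd).add
    ((((((dG'.clm_apply dB).clm_apply dC).clm_apply dd).add
      (((dG'.clm_apply dC).clm_apply dd).clm_apply dB)).sub
      (((dG'.clm_apply dd).clm_apply dB).clm_apply dC)).const_mul (1 / 2))
  have h3 := DFunLike.congr_fun ((h1.congr_of_eventuallyEq he.symm).unique h2) (A y)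
  simp at h3
  have h7 : christoffel G y (A y) d (coordCov G B C y) =
      christoffel G y (A y) d (fderiv ℝ C y (B y)) +
      christoffel G y (A y) d (christoffelRaised G y (B y) (C y)) := by
    simp only [coordCov, christoffel, map_add, _root_.add_apply]
    ring
  rw [form_coordCov (hsymm y hy) (hτ y hy), christoffel_eq_sub hs', h7,
    christoffel_eq_sub hs' _ (fderiv ℝ C y (B y))]
  have h8 (a b : Coord m) : christoffel G y a b d =
    (1 / 2) * (fderiv ℝ G y a b d + fderiv ℝ G y b d a - fderiv ℝ G y d a b) := rfl
  rw [h8 (B y), h8 (fderiv ℝ B y (A y))]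
  linear_combination h3

/-- The curvature tensor computed from the coordinate expression of the connection. -/
theorem form_curvature_eq {G : CoordForm m} {W : Set (Coord m)} (hW : IsOpen W)
    (hG : ContDiffOn ℝ ∞ G W) (hsymm : ∀ y ∈ W, ∀ v w, G y v w = G y w v)
    (hτ : ∀ y ∈ W, metricDet G y ≠ 0) {A B C : Coord m → Coord m}
    (hA : ContDiffOn ℝ ∞ A W) (hB : ContDiffOn ℝ ∞ B W) (hC : ContDiffOn ℝ ∞ C W)
    {y : Coord m} (hy : y ∈ W) (d : Coord m) :
    G y (coordCov G A (coordCov G B C) y - coordCov G B (coordCov G A C) y -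
      coordCov G (fun y ↦ fderiv ℝ B y (A y) - fderiv ℝ A y (B y)) C y) d =
      riem G y (A y) (B y) (C y) d := by
  have hn := hW.mem_nhds hy
  have hCsymm := (hC.contDiffAt hn).isSymmSndFDerivAt (by
    simp only [minSmoothness_of_isRCLikeNormedField]; exact WithTop.coe_le_coe.2 le_top)
  have hGsymm := (hG.contDiffAt hn).isSymmSndFDerivAt (by
    simp only [minSmoothness_of_isRCLikeNormedField]; exact WithTop.coe_le_coe.2 le_top)
  -- After antisymmetrizing in `A, B`, symmetry of second derivatives removes those of `C`, and the
  -- bracket term removes the first derivatives of `A` and `B`; a tensor remains.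
  rw [map_sub, map_sub, _root_.sub_apply, _root_.sub_apply,
    form_coordCov_coordCov hW hG hsymm hτ hB hC hy, form_coordCov_coordCov hW hG hsymm hτ hA hC hy,
    form_coordCov (hsymm y hy) (hτ y hy), hCsymm (B y) (A y), hGsymm (B y) (A y),
    christoffel_christoffelRaised, christoffel_christoffelRaised, riem, hessianPart, polarPart]
  simp only [christoffel, map_sub, _root_.sub_apply]
  ring

section Manifold

variable {M : Type*} [TopologicalSpace M] [ChartedSpace (EuclideanSpace ℝ (Fin m)) M]
  {e : OpenPartialHomeomorph M (Coord m)} {g : FormField m M}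

theorem coordForm_symm (hsymm : ∀ (p : M) (v w : TangentSpace (𝓡 m) p), g p v w = g p w v)
    (y v w : Coord m) : coordForm e g y v w = coordForm e g y w v :=
  hsymm _ _ _

variable [IsManifold (𝓡 m) ∞ M]

/-- The Koszul formula in coordinates. -/
theorem dualConnection_eq (he : e ∈ IsManifold.maximalAtlas (𝓡 m) ∞ M) (hg : SmoothFormField g)
    (hsymm : ∀ (p : M) (v w : TangentSpace (𝓡 m) p), g p v w = g p w v)
    {y : Coord m} (hy : y ∈ e.target) {A B C : VField m M}
    (hA : MDifferentiableAt (𝓡 m) (𝓡 m).tangent (fun p ↦ (⟨p, A p⟩ : TangentBundle (𝓡 m) M))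
      (e.symm y))
    (hB : MDifferentiableAt (𝓡 m) (𝓡 m).tangent (fun p ↦ (⟨p, B p⟩ : TangentBundle (𝓡 m) M))
      (e.symm y))
    (hC : MDifferentiableAt (𝓡 m) (𝓡 m).tangent (fun p ↦ (⟨p, C p⟩ : TangentBundle (𝓡 m) M))
      (e.symm y)) :
    dualConnection g A B C (e.symm y) =
      coordForm e g y (fderiv ℝ (coordField e B) y (coordField e A y)) (coordField e C y)
        + christoffel (coordForm e g) y (coordField e A y) (coordField e B y)
          (coordField e C y) := by
  have dG := (((contDiffOn_coordForm he hg).contDiffAt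
    (e.open_target.mem_nhds hy)).differentiableAt (by simp)).hasFDerivAt
  have hd (A B C : VField m M)
      (hB : MDifferentiableAt (𝓡 m) (𝓡 m).tangent (fun p ↦ (⟨p, B p⟩ : TangentBundle (𝓡 m) M))
        (e.symm y))
      (hC : MDifferentiableAt (𝓡 m) (𝓡 m).tangent (fun p ↦ (⟨p, C p⟩ : TangentBundle (𝓡 m) M))
        (e.symm y)) :
      dirDeriv A (fun q ↦ g q (B q) (C q)) (e.symm y) =
        fderiv ℝ (coordForm e g) y (coordField e A y) (coordField e B y) (coordField e C y)
        + coordForm e g y (fderiv ℝ (coordField e B) y (coordField e A y)) (coordField e C y)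
        + coordForm e g y (coordField e B y)
          (fderiv ℝ (coordField e C) y (coordField e A y)) := by
    rw [dirDeriv_eq he hy A (mdifferentiableAt_form_apply hg hB hC)]
    have h1 := (dG.clm_apply (differentiableAt_coordField he hy hB).hasFDerivAt).clm_apply
      (differentiableAt_coordField he hy hC).hasFDerivAt
    have h2 : (fun q ↦ g q (B q) (C q)) ∘ e.symm =ᶠ[𝓝 y]
        fun x ↦ coordForm e g x (coordField e B x) (coordField e C x) := by
      filter_upwards [e.open_target.mem_nhds hy] with x hx
      exact (coordForm_coordField he g hx B C).symm
    rw [(h1.congr_of_eventuallyEq h2).fderiv]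
    simp
    ring
  have hb (A B C : VField m M)
      (hA : MDifferentiableAt (𝓡 m) (𝓡 m).tangent (fun p ↦ (⟨p, A p⟩ : TangentBundle (𝓡 m) M))
        (e.symm y))
      (hB : MDifferentiableAt (𝓡 m) (𝓡 m).tangent (fun p ↦ (⟨p, B p⟩ : TangentBundle (𝓡 m) M))
        (e.symm y)) :
      g (e.symm y) (VectorField.mlieBracket (𝓡 m) A B (e.symm y)) (C (e.symm y)) =
        coordForm e g y (fderiv ℝ (coordField e B) y (coordField e A y)) (coordField e C y)
        - coordForm e g y (fderiv ℝ (coordField e A) y (coordField e B y)) (coordField e C y) := by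
    rw [← coordForm_coordField he g hy, coordField_mlieBracket he hy hA hB, map_sub,
      _root_.sub_apply]
  rw [dualConnection, hd A B C hB hC, hd B C A hC hA, hd C A B hA hB, hb A B C hA hB,
    hb B C A hB hC, hb C A B hC hA, christoffel]
  have hs := coordForm_symm (e := e) hsymm y
  rw [hs (coordField e B y) (fderiv ℝ (coordField e C) y (coordField e A y)),
    hs (coordField e C y) (fderiv ℝ (coordField e A) y (coordField e B y)),
    hs (coordField e A y) (fderiv ℝ (coordField e B) y (coordField e C y))]
  ring

/-- The coordinate expression of the Levi-Civita connection. -/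
theorem coordField_leviCivita (he : e ∈ IsManifold.maximalAtlas (𝓡 m) ∞ M)
    (hg : SmoothFormField g)
    (hsymm : ∀ (p : M) (v w : TangentSpace (𝓡 m) p), g p v w = g p w v)
    {y : Coord m} (hy : y ∈ e.target) (hτ : metricDet (coordForm e g) y ≠ 0) {A B : VField m M}
    (hA : MDifferentiableAt (𝓡 m) (𝓡 m).tangent (fun p ↦ (⟨p, A p⟩ : TangentBundle (𝓡 m) M))
      (e.symm y))
    (hB : MDifferentiableAt (𝓡 m) (𝓡 m).tangent (fun p ↦ (⟨p, B p⟩ : TangentBundle (𝓡 m) M))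
      (e.symm y)) :
    coordField e (leviCivita g A B) y =
      fderiv ℝ (coordField e B) y (coordField e A y) +
        christoffelRaised (coordForm e g) y (coordField e A y) (coordField e B y) := by
  have hs := coordForm_symm (e := e) hsymm y
  have hex : ∃ v, RepresentsDual g A B (e.symm y) v := by
    refine ⟨coordFrame e y (fderiv ℝ (coordField e B) y (coordField e A y) +
      christoffelRaised (coordForm e g) y (coordField e A y) (coordField e B y)), fun C hC ↦ ?_⟩
    rw [dualConnection_eq he hg hsymm hy hA hB hC, ← coordFrame_coordField he hy C,
      ← coordForm_apply, map_add, _root_.add_apply, form_christoffelRaised hs hτ]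
  have h1 : leviCivita g A B (e.symm y) = hex.choose := by
    rw [leviCivita, dif_pos hex]
  have h2 := hex.choose_spec
  rw [← h1] at h2
  -- Fields with constant coordinate expression suffice as test fields for uniqueness.
  refine form_nondegenerate hs hτ fun c ↦ ?_
  have hl : coordField e (liftField e fun _ ↦ c) y = c := coordField_liftField he hy _
  have hc := h2 (liftField e fun _ ↦ c)
    ((contMDiffAt_liftField he (e.map_target hy) contDiffAt_const).mdifferentiableAt (by simp))
  rw [dualConnection_eq he hg hsymm hy hA hB
    ((contMDiffAt_liftField he (e.map_target hy) contDiffAt_const).mdifferentiableAt (by simp)),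
    ← coordForm_coordField he g hy, hl] at hc
  rw [hc, map_add, _root_.add_apply, form_christoffelRaised hs hτ]

/-- The curvature tensor in coordinates. -/
theorem form_curvature (he : e ∈ IsManifold.maximalAtlas (𝓡 m) ∞ M) (hg : SmoothFormField g)
    (hsymm : ∀ (p : M) (v w : TangentSpace (𝓡 m) p), g p v w = g p w v)
    {y : Coord m} (hy : y ∈ e.target) (hτ : metricDet (coordForm e g) y ≠ 0) {A B C : VField m M}
    (hA : SmoothVField A) (hB : SmoothVField B) (hC : SmoothVField C) (D : VField m M) :
    g (e.symm y) (curvature g A B C (e.symm y)) (D (e.symm y)) =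
      riem (coordForm e g) y (coordField e A y) (coordField e B y) (coordField e C y)
        (coordField e D y) := by
  have hG := contDiffOn_coordForm he hg
  set W : Set (Coord m) := e.target ∩ (metricDet (coordForm e g)) ⁻¹' {0}ᶜ with hWdef
  have hW : IsOpen W := (contDiffOn_metricDet hG).continuousOn.isOpen_inter_preimage e.open_target
    isOpen_compl_singleton
  have hsub : W ⊆ e.target := Set.inter_subset_left
  have hcd (A : VField m M) (hA : SmoothVField A) : ContDiffOn ℝ ∞ (coordField e A) W :=
    fun y hy ↦ (contDiffAt_coordField he (hsub hy) (hA _)).contDiffWithinAt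
  have hmd (A : VField m M) (hA : SmoothVField A) (p : M) :
      MDifferentiableAt (𝓡 m) (𝓡 m).tangent (fun p ↦ (⟨p, A p⟩ : TangentBundle (𝓡 m) M)) p :=
    (hA p).mdifferentiableAt (by simp)
  have hLC (A B : VField m M) (hA : SmoothVField A) (hB : SmoothVField B) :
      ∀ x ∈ W, coordField e (leviCivita g A B) x = coordCov (coordForm e g) (coordField e A) (coordField e B) x :=
    fun x hx ↦ coordField_leviCivita he hg hsymm hx.1 hx.2 (hmd A hA _) (hmd B hB _)
  have hyW : y ∈ W := ⟨hy, hτ⟩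
  have hWn := hW.mem_nhds hyW
  have hcdN (A B : VField m M) (hA : SmoothVField A) (hB : SmoothVField B) :
      ContDiffOn ℝ ∞ (coordCov (coordForm e g) (coordField e A) (coordField e B)) W :=
    contDiffOn_coordCov hW (hG.mono hsub) (fun x hx ↦ hx.2) (hcd A hA) (hcd B hB)
  have hLC2 (A B C : VField m M) (hA : SmoothVField A) (hB : SmoothVField B)
      (hC : SmoothVField C) : coordField e (leviCivita g A (leviCivita g B C)) y =
        coordCov (coordForm e g) (coordField e A) (coordCov (coordForm e g) (coordField e B) (coordField e C)) y := by
    -- The outer derivative needs the inner one as a germ, so the coordinate formula is used on a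
    -- whole neighbourhood within the nonsingular set.
    have h1 : coordField e (leviCivita g B C) =ᶠ[𝓝 y] coordCov (coordForm e g) (coordField e B) (coordField e C) := by
      filter_upwards [hWn] with x hx using hLC B C hB hC x hx
    have h2 : DifferentiableAt ℝ (coordField e (leviCivita g B C)) y :=
      h1.differentiableAt_iff.2 (((hcdN B C hB hC).contDiffAt hWn).differentiableAt (by simp))
    rw [coordField_leviCivita he hg hsymm hy hτ (hmd A hA _)
      (mdifferentiableAt_of_coordField he hy h2), h1.fderiv_eq, h1.self_of_nhds]
    rfl
  have hbr : ∀ x ∈ e.target, coordField e (VectorField.mlieBracket (𝓡 m) A B) x =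
      fderiv ℝ (coordField e B) x (coordField e A x)
        - fderiv ℝ (coordField e A) x (coordField e B x) :=
    fun x hx ↦ coordField_mlieBracket he hx (hmd A hA _) (hmd B hB _)
  have hbr3 : coordField e (leviCivita g (VectorField.mlieBracket (𝓡 m) A B) C) y =
      coordCov (coordForm e g) (fun x ↦ fderiv ℝ (coordField e B) x (coordField e A x)
        - fderiv ℝ (coordField e A) x (coordField e B x)) (coordField e C) y := by
    have h1 : coordField e (VectorField.mlieBracket (𝓡 m) A B) =ᶠ[𝓝 y]
        fun x ↦ fderiv ℝ (coordField e B) x (coordField e A x)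
          - fderiv ℝ (coordField e A) x (coordField e B x) := by
      filter_upwards [hWn] with x hx using hbr x hx.1
    have h2 : DifferentiableAt ℝ (coordField e (VectorField.mlieBracket (𝓡 m) A B)) y := by
      refine h1.differentiableAt_iff.2 (ContDiffAt.differentiableAt (n := ∞) ?_ (by simp))
      exact ((((hcd B hB).fderiv_of_isOpen hW (by simp)).clm_apply (hcd A hA)).sub
        (((hcd A hA).fderiv_of_isOpen hW (by simp)).clm_apply (hcd B hB))).contDiffAt hWn
    rw [coordField_leviCivita he hg hsymm hy hτ (mdifferentiableAt_of_coordField he hy h2)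
      (hmd C hC _), hbr y hy]
    rfl
  rw [← coordForm_coordField he g hy, ← form_curvature_eq hW (hG.mono hsub)
    (fun x _ ↦ coordForm_symm hsymm x) (fun x hx ↦ hx.2) (hcd A hA) (hcd B hB) (hcd C hC) hyW, ← hLC2 A B C hA hB hC, ← hLC2 B A C hB hA hC, ← hbr3]
  congr 2
  have hsub3 (X Y Z : VField m M) :
      coordField e (fun p ↦ X p - Y p - Z p) y =
        coordField e X y - coordField e Y y - coordField e Z y := by
    change (mfderiv (𝓡 m) (𝓡 m) e.symm y).inverse _ = _
    rw [map_sub, map_sub]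
    rfl
  exact hsub3 _ _ _

end Manifold

end CurvatureInCharts

/-! ### Gluing the local perturbation into the manifold. -/

section Modification

set_option maxSynthPendingDepth 3

theorem rank_eq_two_iff (N : Matrix (Fin 2) (Fin 2) ℝ) : N.rank = 2 ↔ N.det ≠ 0 := by
  constructor
  · intro h hd
    obtain ⟨v, hv, hv0⟩ := Matrix.exists_mulVec_eq_zero_iff.2 hd
    have h1 := LinearMap.finrank_range_add_finrank_ker N.mulVecLin
    rw [← Matrix.rank, h] at h1
    simp only [Module.finrank_fintype_fun_eq_card, Fintype.card_fin] at h1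
    have h2 : LinearMap.ker N.mulVecLin = ⊥ := Submodule.finrank_eq_zero.1 (by omega)
    exact hv ((Submodule.mem_bot ℝ).1 (h2 ▸ (show v ∈ LinearMap.ker N.mulVecLin from hv0)))
  · intro h
    simpa using Matrix.rank_of_isUnit N ((Matrix.isUnit_iff_isUnit_det N).2 h.isUnit)

variable {m : ℕ} {M : Type*} [TopologicalSpace M] [ChartedSpace (EuclideanSpace ℝ (Fin m)) M]
  {e : OpenPartialHomeomorph M (Coord m)} {g : FormField m M}

theorem det_gram (g : FormField m M) (A B : VField m M) (p : M) :
    (gram g A B p).det = g p (A p) (A p) * g p (B p) (B p) - g p (A p) (B p) * g p (B p) (A p) := by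
  rw [gram, Matrix.det_fin_two_of]

theorem det_gram_eq_areaForm (he : e ∈ IsManifold.maximalAtlas (𝓡 m) ∞ M) (g : FormField m M)
    {y : Coord m} (hy : y ∈ e.target) (A B : VField m M) :
    (gram g A B (e.symm y)).det = areaForm (coordForm e g) y (coordField e A y) (coordField e B y)
      (coordField e A y) (coordField e B y) := by
  rw [det_gram, areaForm]
  simp only [coordForm_coordField he g hy]

theorem coordForm_eq_zero_iff (he : e ∈ IsManifold.maximalAtlas (𝓡 m) ∞ M) {y : Coord m}
    (hy : y ∈ e.target) (v : Coord m) :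
    coordForm e g y v = 0 ↔ coordFrame e y v ∈ radical g (e.symm y) := by
  rw [radical, LinearMap.mem_ker]
  constructor
  · intro h
    refine ContinuousLinearMap.ext fun w ↦ ?_
    obtain ⟨w, rfl⟩ := coordFrame_surjective he hy w
    exact DFunLike.congr_fun h w
  · intro h
    refine ContinuousLinearMap.ext fun w ↦ ?_
    exact DFunLike.congr_fun h (coordFrame e y w)

theorem mem_singularSet_iff (he : e ∈ IsManifold.maximalAtlas (𝓡 m) ∞ M)
    (hsymm : ∀ (p : M) (v w : TangentSpace (𝓡 m) p), g p v w = g p w v) {y : Coord m}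
    (hy : y ∈ e.target) : e.symm y ∈ singularSet g ↔ metricDet (coordForm e g) y = 0 := by
  rw [metricDet_eq_zero_iff (coordForm_symm hsymm y), singularSet, Set.mem_ofPred_eq,
    Submodule.ne_bot_iff]
  constructor
  · rintro ⟨v, hv, hv0⟩
    obtain ⟨v, rfl⟩ := coordFrame_surjective he hy v
    refine ⟨v, ?_, (coordForm_eq_zero_iff he hy v).2 hv⟩
    rintro rfl
    exact hv0 (map_zero _)
  · rintro ⟨v, hv0, hv⟩
    refine ⟨_, (coordForm_eq_zero_iff he hy v).1 hv, fun h ↦ hv0 ?_⟩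
    exact coordFrame_injective he hy (h.trans (map_zero _).symm)

/-- A curve inside `S` makes `f` constantly zero along it near time `0`; the chain rule does the
rest. With `f = det g` it turns the tangency hypothesis into `dτ(R) = 0`. -/
theorem fderiv_eq_zero_of_tangentTo (he : e ∈ IsManifold.maximalAtlas (𝓡 m) ∞ M)
    {S : Set M} {y : Coord m} (hy : y ∈ e.target) {v : Coord m}
    (hv : TangentTo S (e.symm y) (coordFrame e y v)) {f : Coord m → ℝ}
    (hf : DifferentiableAt ℝ f y) (hS : ∀ y ∈ e.target, e.symm y ∈ S → f y = 0) :
    fderiv ℝ f y v = 0 := by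
  obtain ⟨γ, hγ, hγS, hγ0⟩ := hv
  have h0 : γ 0 = e.symm y := congrArg Bundle.TotalSpace.proj hγ0
  have hp := e.map_target hy
  have hγd : MDifferentiableAt 𝓘(ℝ, ℝ) (𝓡 m) γ 0 := (hγ 0).mdifferentiableAt (by simp)
  have hed : MDifferentiableAt (𝓡 m) (𝓡 m) e (e.symm y) :=
    (mdifferentiable_of_mem_maximalAtlas he).mdifferentiableAt hp
  have h1 : mfderiv 𝓘(ℝ, ℝ) (𝓡 m) (e ∘ γ) 0 (1 : ℝ) = v := by
    rw [mfderiv_comp 0 (h0 ▸ hed) hγd]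
    have h2 := congrArg (fun z : TangentBundle (𝓡 m) M ↦
      (mfderiv (𝓡 m) (𝓡 m) e z.1 z.2 : Coord m)) hγ0
    refine h2.trans ?_
    exact DFunLike.congr_fun ((mdifferentiable_of_mem_maximalAtlas he).comp_symm_deriv hy) v
  have hc : DifferentiableAt ℝ (e ∘ γ) 0 := by
    rw [← mdifferentiableAt_iff_differentiableAt]
    exact MDifferentiableAt.comp 0 (h0 ▸ hed) hγd
  have hc0 : (e ∘ γ) 0 = y := by rw [Function.comp_apply, h0, e.right_inv hy]
  have h3 : HasFDerivAt (f ∘ (e ∘ γ)) ((fderiv ℝ f y).comp (fderiv ℝ (e ∘ γ) 0)) 0 :=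
    (hc0.symm ▸ hf.hasFDerivAt : HasFDerivAt f (fderiv ℝ f y) ((e ∘ γ) 0)).comp 0 hc.hasFDerivAt
  have h4 : f ∘ (e ∘ γ) =ᶠ[𝓝 0] fun _ ↦ 0 := by
    have : ∀ᶠ t in 𝓝 (0 : ℝ), γ t ∈ e.source :=
      hγ.continuous.continuousAt.eventually_mem (e.open_source.mem_nhds (h0 ▸ hp))
    filter_upwards [this] with t ht
    exact hS _ (e.map_source ht) (by rw [Function.comp_apply, e.left_inv ht]; exact hγS t)
  have h5 := DFunLike.congr_fun
    ((h3.congr_of_eventuallyEq h4.symm).unique (hasFDerivAt_const (0 : ℝ) (0 : ℝ))) (1 : ℝ)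
  rw [ContinuousLinearMap.comp_apply] at h5
  rw [← h1, mfderiv_eq_fderiv]
  exact h5

theorem coordField_congr (he : e ∈ IsManifold.maximalAtlas (𝓡 m) ∞ M) {y : Coord m}
    (hy : y ∈ e.target) {V W : VField m M} (h : V (e.symm y) = W (e.symm y)) :
    coordField e V y = coordField e W y := by
  refine coordFrame_injective he hy ?_
  rw [coordFrame_coordField he hy, coordFrame_coordField he hy, h]

open Classical in
/-- The extension by zero of a vector field given on the source of a chart. -/
def extendField (e : OpenPartialHomeomorph M (Coord m)) (v : Coord m → Coord m) : VField m M :=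
  fun p ↦ if p ∈ e.source then liftField e v p else 0

theorem extendField_symm (he : e ∈ IsManifold.maximalAtlas (𝓡 m) ∞ M) {y : Coord m}
    (hy : y ∈ e.target) (v : Coord m → Coord m) :
    extendField e v (e.symm y) = coordFrame e y (v y) := by
  rw [extendField, if_pos (e.map_target hy), liftField_eq_coordFrame he hy]

theorem extendField_eq_zero (he : e ∈ IsManifold.maximalAtlas (𝓡 m) ∞ M) {p : M}
    {v : Coord m → Coord m} (hv : p ∈ e.source → v (e p) = 0) : extendField e v p = 0 := by
  by_cases hp : p ∈ e.source
  · obtain ⟨y, hy, rfl⟩ : ∃ y ∈ e.target, e.symm y = p := ⟨e p, e.map_source hp, e.left_inv hp⟩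
    have := hv hp
    rw [e.right_inv hy] at this
    rw [extendField_symm he hy, this, map_zero]
  · rw [extendField, if_neg hp]

theorem coordField_add_extendField (he : e ∈ IsManifold.maximalAtlas (𝓡 m) ∞ M) {y : Coord m}
    (hy : y ∈ e.target) (V : VField m M) (v : Coord m → Coord m) :
    coordField e (fun p ↦ V p + extendField e v p) y = coordField e V y + v y := by
  refine coordFrame_injective he hy ?_
  rw [coordFrame_coordField he hy, map_add, coordFrame_coordField he hy, extendField_symm he hy]

variable [IsManifold (𝓡 m) ∞ M]

theorem sectionalCurvature_eq (he : e ∈ IsManifold.maximalAtlas (𝓡 m) ∞ M)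
    (hg : SmoothFormField g) (hsymm : ∀ (p : M) (v w : TangentSpace (𝓡 m) p), g p v w = g p w v)
    {y : Coord m} (hy : y ∈ e.target) (hτ : metricDet (coordForm e g) y ≠ 0) {A B : VField m M}
    (hA : SmoothVField A) (hB : SmoothVField B) :
    sectionalCurvature g A B (e.symm y) =
      riem (coordForm e g) y (coordField e A y) (coordField e B y) (coordField e A y)
        (coordField e B y) / areaForm (coordForm e g) y (coordField e A y) (coordField e B y)
        (coordField e A y) (coordField e B y) := by
  rw [sectionalCurvature, form_curvature he hg hsymm hy hτ hA hB hA, det_gram_eq_areaForm he g hy]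

theorem exists_chart (p : M) : ∃ e ∈ IsManifold.maximalAtlas (𝓡 m) ∞ M, ∃ y ∈ e.target,
    e.symm y = p :=
  ⟨_, IsManifold.chart_mem_maximalAtlas p, _, mem_chart_target (Coord m) p,
    (chartAt (Coord m) p).left_inv (mem_chart_source (Coord m) p)⟩

/-- The sectional curvature at a point depends only on the vectors at this point. -/
theorem sectionalCurvature_congr
    (hg : SmoothFormField g) (hsymm : ∀ (p : M) (v w : TangentSpace (𝓡 m) p), g p v w = g p w v)
    {p : M} (hp : p ∉ singularSet g) {A B A' B' : VField m M}
    (hA : SmoothVField A) (hB : SmoothVField B) (hA' : SmoothVField A') (hB' : SmoothVField B')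
    (h1 : A p = A' p) (h2 : B p = B' p) :
    sectionalCurvature g A B p = sectionalCurvature g A' B' p := by
  obtain ⟨e, he, y, hy, rfl⟩ := exists_chart (m := m) p
  have hτ := mt (mem_singularSet_iff he hsymm hy).2 hp
  rw [sectionalCurvature_eq he hg hsymm hy hτ hA hB, sectionalCurvature_eq he hg hsymm hy hτ hA' hB',
    coordField_congr he hy h1, coordField_congr he hy h2]

/-- Hausdorffness makes the image of the compact support closed in `M`, so the field vanishes near
every point outside the chart domain. -/
theorem smoothVField_extendField [T2Space M] (he : e ∈ IsManifold.maximalAtlas (𝓡 m) ∞ M)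
    {v : Coord m → Coord m} (hv : ContDiff ℝ ∞ v) {S : Set (Coord m)} (hS : IsCompact S)
    (hSe : S ⊆ e.target) (hv0 : ∀ y ∉ S, v y = 0) : SmoothVField (extendField e v) := by
  intro p
  by_cases hp : p ∈ e.source
  · refine (contMDiffAt_liftField he hp hv.contDiffAt).congr_of_eventuallyEq ?_
    filter_upwards [e.open_source.mem_nhds hp] with q hq
    rw [extendField, if_pos hq]
  · have hc : IsClosed (e.symm '' S) := (hS.image_of_continuousOn
      (e.symm.continuousOn.mono hSe)).isClosed
    have hpS : p ∉ e.symm '' S := by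
      rintro ⟨y, hy, rfl⟩
      exact hp (e.map_target (hSe hy))
    have h0 : ContMDiffAt (𝓡 m) (𝓡 m).tangent ∞
        (fun p ↦ (⟨p, 0⟩ : TangentBundle (𝓡 m) M)) p :=
      (Bundle.contMDiff_zeroSection ℝ (TangentSpace (𝓡 m) : M → Type _)).contMDiffAt
    refine h0.congr_of_eventuallyEq ?_
    filter_upwards [hc.isOpen_compl.mem_nhds hpS] with q hq
    rw [extendField_eq_zero he fun hqs ↦ hv0 _ fun h ↦ hq ⟨_, h, e.left_inv hqs⟩]

theorem SmoothVField.add {A B : VField m M} (hA : SmoothVField A) (hB : SmoothVField B) :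
    SmoothVField fun p ↦ A p + B p :=
  ContMDiff.add_section hA hB

/-- A pair of vector fields whose sectional curvature has a good limit, and which spans a plane
containing the radical along the singular set, can be modified outside the singular set so that
the limit changes. -/
theorem exists_modification [T2Space M] (hg : IsTransverseRiemannLorentzTangent g)
    {A B : VField m M} (hA : SmoothVField A) (hB : SmoothVField B) {K : M → ℝ}
    (hK : HasLimitingCurvature g A B K)
    (hrank : ∀ p ∈ singularSet g, (gram g A B p).rank = 1)
    (hrad : ∀ p ∈ singularSet g, radical g p ≤ Submodule.span ℝ {A p, B p})
    {p₀ : M} (hp₀ : p₀ ∈ singularSet g) :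
    ∃ (A' B' : VField m M) (K' : M → ℝ), SmoothVField A' ∧ SmoothVField B' ∧
      (∀ p ∈ singularSet g, A' p = A p ∧ B' p = B p) ∧ HasLimitingCurvature g A' B' K' ∧
      K' p₀ ≠ K p₀ := by
  obtain ⟨U, hU, hsub, hKU, hKeq⟩ := hK
  obtain ⟨e, he, y₀, hy₀, rfl⟩ := exists_chart (m := m) p₀
  have hsymm := hg.symm
  have hmem {y : Coord m} (hy : y ∈ e.target) := mem_singularSet_iff he hsymm hy
  set W : Set (Coord m) := e.target ∩ e.symm ⁻¹' U with hWdef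
  have hW : IsOpen W := e.symm.isOpen_inter_preimage hU
  have hG := contDiffOn_coordForm he hg.smooth
  have hcd (V : VField m M) (hV : SmoothVField V) : ContDiffOn ℝ ∞ (coordField e V) W :=
    fun y hy ↦ (contDiffAt_coordField he hy.1 (hV _)).contDiffWithinAt
  have hkW : ContDiffOn ℝ ∞ (K ∘ e.symm) W := by
    refine contMDiffOn_iff_contDiffOn.1 fun y hy ↦ ContMDiffAt.contMDiffWithinAt ?_
    exact ContMDiffAt.comp y (hKU.contMDiffAt (hU.mem_nhds hy.2)) (contMDiffAt_chart_symm he hy.1)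
  have hdeg : ∀ y ∈ W, metricDet (coordForm e g) y = 0 →
      areaForm (coordForm e g) y (coordField e A y) (coordField e B y) (coordField e A y)
        (coordField e B y) = 0 := by
    intro y hy hτ
    have h1 := hrank _ ((hmem hy.1).2 hτ)
    rw [← det_gram_eq_areaForm he g hy.1]
    by_contra h2
    have h3 := (rank_eq_two_iff _).2 h2
    omega
  obtain ⟨S, O, u, v, k', hS, hSW, hyS, hO, hOW, hSO, hu, hv, huS, huv0, hk', hkk', hgood, hne⟩ :=
    exists_local_modification (G := coordForm e g) (a := coordField e A) (b := coordField e B)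
      (k := K ∘ e.symm) hW ⟨hy₀, hsub hp₀⟩ ((hmem hy₀).1 hp₀) (hG.mono Set.inter_subset_left)
      (fun y _ ↦ coordForm_symm hsymm y)
      -- `coordDet g e` and `metricDet (coordForm e g)` are equal by definition.
      (fun y hy hτ ↦ hg.transverse e he y hy.1 ((hmem hy.1).2 hτ))
      (fun y hy hτ v hv ↦ fderiv_eq_zero_of_tangentTo he hy.1
        (hg.tangent_radical _ ((hmem hy.1).2 hτ) _ ((coordForm_eq_zero_iff he hy.1 v).1 hv))
        (((contDiffOn_metricDet hG).contDiffAt (e.open_target.mem_nhds hy.1)).differentiableAt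
          (by simp)) fun x hx ↦ (hmem hx).1)
      (hcd A hA) (hcd B hB) hkW hdeg
      (by
        -- If both diagonal entries vanished, the zero determinant would kill the off-diagonal entry
        -- too, and the rank would be `0` rather than `1`.
        rintro y hy hτ ⟨h1, h2⟩
        have h3 := hdeg y hy hτ
        have h4 := hrank _ ((hmem hy.1).2 hτ)
        rw [areaForm, h1, h2, coordForm_symm hsymm y (coordField e B y) (coordField e A y)] at h3
        have h5 : coordForm e g y (coordField e A y) (coordField e B y) = 0 := by
          simpa using h3
        rw [coordForm_coordField he g hy.1] at h1 h2 h5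
        have h6 : gram g A B (e.symm y) = 0 := by
          rw [gram, hsymm _ (B (e.symm y)) (A (e.symm y)), h1, h2, h5]
          ext i j
          fin_cases i <;> fin_cases j <;> rfl
        rw [h6, Matrix.rank_zero] at h4
        omega)
      (by
        intro y hy hτ v hv
        have h1 := hrad _ ((hmem hy.1).2 hτ) ((coordForm_eq_zero_iff he hy.1 v).1 hv)
        obtain ⟨α, β, h2⟩ := Submodule.mem_span_pair.1 h1
        refine Submodule.mem_span_pair.2 ⟨α, β, coordFrame_injective he hy.1 ?_⟩
        rw [map_add, map_smul, map_smul, coordFrame_coordField he hy.1,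
          coordFrame_coordField he hy.1, h2])
      (by
        intro y hy hτ
        obtain ⟨h1, h2⟩ := hKeq _ hy.2 (mt (hmem hy.1).1 hτ)
        rw [rank_eq_two_iff, det_gram_eq_areaForm he g hy.1] at h1
        rw [sectionalCurvature_eq he hg.smooth hsymm hy.1 hτ hA hB, eq_div_iff h1] at h2
        exact h2.symm)
  have hSe : S ⊆ e.target := hSW.trans Set.inter_subset_left
  have hcl : IsClosed (e.symm '' S) := (hS.image_of_continuousOn
    (e.symm.continuousOn.mono hSe)).isClosed
  have hsm (V : VField m M) (hV : SmoothVField V) {w : Coord m → Coord m} (hw : ContDiff ℝ ∞ w)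
      (hw0 : ∀ y ∉ S, w y = 0) : SmoothVField fun p ↦ V p + extendField e w p :=
    hV.add (smoothVField_extendField he hw hS hSe hw0)
  have hA' := hsm A hA hu fun y hy ↦ (huS y hy).1
  have hB' := hsm B hB hv fun y hy ↦ (huS y hy).2
  have hmemS {p : M} (hp : p ∈ e.source) (h : p ∉ e.symm '' S) : e p ∉ S :=
    fun h1 ↦ h ⟨_, h1, e.left_inv hp⟩
  have hoff {p : M} (hp : p ∉ e.symm '' S) :
      A p + extendField e u p = A p ∧ B p + extendField e v p = B p := by
    rw [extendField_eq_zero he fun h ↦ (huS _ (hmemS h hp)).1,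
      extendField_eq_zero he fun h ↦ (huS _ (hmemS h hp)).2, add_zero, add_zero]
    exact ⟨rfl, rfl⟩
  classical
  -- The two definitions are compatible: on `O` outside `S` the function `k'` equals `k`. Hence `K'`
  -- is `k' ∘ e` on all of the preimage of `O`, which is open, although `S` is not.
  set K' : M → ℝ := fun p ↦ if p ∈ e.symm '' S then k' (e p) else K p with hK'
  have hK'O : ∀ p ∈ e.source ∩ e ⁻¹' O, K' p = k' (e p) := by
    rintro p ⟨hp, hpO⟩
    by_cases hpS : p ∈ e.symm '' S
    · rw [hK']
      exact if_pos hpS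
    · rw [hkk' _ hpO (hmemS hp hpS), Function.comp_apply, e.left_inv hp, hK']
      exact if_neg hpS
  have hOopen : IsOpen (e.source ∩ e ⁻¹' O) := e.isOpen_inter_preimage hO
  have hUopen : IsOpen (U \ e.symm '' S) := hU.sdiff hcl
  -- The new neighbourhood joins the part of `U` away from the perturbation to the chart domain of
  -- `k'`; singular points in `S` lie in the latter.
  refine ⟨_, _, K', hA', hB', ?_, ⟨U \ e.symm '' S ∪ e.source ∩ e ⁻¹' O, hUopen.union hOopen,
    ?_, ?_, ?_⟩, ?_⟩
  · intro p hp
    have hz {p : M} (hp : p ∈ singularSet g) (hps : p ∈ e.source) :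
        u (e p) = 0 ∧ v (e p) = 0 :=
      huv0 _ ((hmem (e.map_source hps)).1 (by rwa [e.left_inv hps]))
    rw [extendField_eq_zero he fun h ↦ (hz hp h).1, extendField_eq_zero he fun h ↦ (hz hp h).2,
      add_zero, add_zero]
    exact ⟨rfl, rfl⟩
  · intro p hp
    by_cases hpS : p ∈ e.symm '' S
    · obtain ⟨y, hy, rfl⟩ := hpS
      refine Or.inr ⟨e.map_target (hSe hy), ?_⟩
      rw [Set.mem_preimage, e.right_inv (hSe hy)]
      exact hSO y hy ((hmem (hSe hy)).1 hp)
    · exact Or.inl ⟨hsub hp, hpS⟩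
  · rintro p (hp | hp)
    · refine ContMDiffAt.contMDiffWithinAt ?_
      refine (hKU.contMDiffAt (hU.mem_nhds hp.1)).congr_of_eventuallyEq ?_
      filter_upwards [hUopen.mem_nhds hp] with q hq using if_neg hq.2
    · refine ContMDiffAt.contMDiffWithinAt ?_
      have h1 : ContMDiffAt (𝓡 m) 𝓘(ℝ, ℝ) ∞ (k' ∘ e) p :=
        ContMDiffAt.comp p (hk'.contDiffAt (hO.mem_nhds hp.2)).contMDiffAt
          (contMDiffAt_of_mem_maximalAtlas he hp.1)
      refine h1.congr_of_eventuallyEq ?_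
      filter_upwards [hOopen.mem_nhds hp] with q hq using hK'O q hq
  · rintro p (hp | hp) hpns
    · obtain ⟨h1, h2⟩ := hoff hp.2
      obtain ⟨h3, h4⟩ := hKeq p hp.1 hpns
      have h5 : K' p = K p := if_neg hp.2
      rw [h5, h4, ← sectionalCurvature_congr hg.smooth hsymm hpns hA' hB' hA hB h1 h2]
      refine ⟨?_, rfl⟩
      refine Eq.trans (congrArg Matrix.rank ?_) h3
      rw [gram, gram]
      simp only [h1, h2]
    · rw [hK'O p hp]
      obtain ⟨y, hy, rfl⟩ : ∃ y ∈ e.target, e.symm y = p :=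
        ⟨e p, e.map_source hp.1, e.left_inv hp.1⟩
      have hyO : y ∈ O := by
        have := hp.2
        rwa [Set.mem_preimage, e.right_inv hy] at this
      have hτ := mt (hmem hy).2 hpns
      obtain ⟨h1, h2⟩ := hgood y hyO hτ
      rw [rank_eq_two_iff, det_gram_eq_areaForm he g hy,
        sectionalCurvature_eq he hg.smooth hsymm hy hτ hA' hB', e.right_inv hy,
        coordField_add_extendField he hy, coordField_add_extendField he hy]
      exact ⟨h1, (eq_div_iff h1).2 h2.symm⟩
  · rw [hK'O _ ⟨e.map_target hy₀, by
      rw [Set.mem_preimage, e.right_inv hy₀]; exact hSO y₀ hyS ((hmem hy₀).1 hp₀)⟩, e.right_inv hy₀]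
    exact hne

end Modification

end SingularMetric

end

theorem mainTheorem9 (m : ℕ) (hm : 2 < m)
    (M : Type*) [TopologicalSpace M] [T2Space M] [SecondCountableTopology M] [ConnectedSpace M]
    [ChartedSpace (EuclideanSpace ℝ (Fin m)) M] [IsManifold (𝓡 m) ∞ M]
    (g : SingularMetric.FormField m M)
    (hg : SingularMetric.IsTransverseRiemannLorentzTangent g)
    (A B : SingularMetric.VField m M)
    (hA : SingularMetric.SmoothVFieldOn A (SingularMetric.singularSet g))
    (hB : SingularMetric.SmoothVFieldOn B (SingularMetric.singularSet g))
    (hrank : ∀ p ∈ SingularMetric.singularSet g, (SingularMetric.gram g A B p).rank = 1)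
    (hR : ∀ p ∈ SingularMetric.singularSet g,
      SingularMetric.radical g p ≤ Submodule.span ℝ {A p, B p}) :
    ¬ SingularMetric.SectionalCurvatureWellDefined g A B := by
  rintro ⟨⟨𝒜, ℬ, K, h𝒜, hℬ, hK⟩, huniq⟩
  obtain ⟨p, hp⟩ := hg.singular_nonempty
  have hgram : ∀ q ∈ SingularMetric.singularSet g,
      SingularMetric.gram g 𝒜 ℬ q = SingularMetric.gram g A B q := by
    intro q hq
    rw [SingularMetric.gram, SingularMetric.gram, h𝒜.2 q hq, hℬ.2 q hq]
  -- The rank and radical conditions involve only values on the singular set, so they pass from `A,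
  -- B` to any extension; any good pair can then be modified at a single singular point.
  obtain ⟨𝒜', ℬ', K', h𝒜', hℬ', heq, hK', hne⟩ := SingularMetric.exists_modification hg h𝒜.1 hℬ.1 hK
    (fun q hq ↦ by rw [hgram q hq]; exact hrank q hq)
    (fun q hq ↦ by rw [h𝒜.2 q hq, hℬ.2 q hq]; exact hR q hq) hp
  exact hne (huniq 𝒜' ℬ' 𝒜 ℬ K' K ⟨h𝒜', fun q hq ↦ (heq q hq).1.trans (h𝒜.2 q hq)⟩
    ⟨hℬ', fun q hq ↦ (heq q hq).2.trans (hℬ.2 q hq)⟩ hK' h𝒜 hℬ hK p hp)
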